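/- Let $\epsilon\in\{1,-1\}$. Consider smooth coframings $(\sigma^0,\dots,\sigma^4)$ on $5$-dimensional smooth manifolds that satisfy the structure equations $$\begin{aligned} d\sigma^0&=-\epsilon\,\sigma^0\wedge(\sigma^2-\sigma^4)+\sigma^1\wedge\sigma^2+\sigma^3\wedge\sigma^4,\\ d\sigma^1&=\epsilon\,\sigma^1\wedge(\sigma^2+\sigma^3+\sigma^4),\\ d\sigma^2&=\sigma^0\wedge(\sigma^2-\sigma^4)-\epsilon(\sigma^1-\sigma^3)\wedge\sigma^2,\\ d\sigma^3&=-\epsilon\,\sigma^3\wedge(\sigma^1+\sigma^2+\sigma^4),\\ d\sigma^4&=-\sigma^0\wedge(\sigma^2-\sigma^4)-\epsilon(\sigma^1-\sigma^3)\wedge\sigma^4, \end{aligned}\tag{1}$$ and let $\mathcal I_\sigma$ be the differential ideal generated by $\sigma^0,\ \sigma^1\wedge\sigma^2,\ \sigma^3\wedge\sigma^4$ (the algebraic ideal generated by these forms and their exterior derivatives). On the open subset $D=\{x+y\neq0,\ pq>0\}$ of $J^1(\mathbb R^2,\mathbb R)$, with coordinates $(x,y,z,p,q)$, let $$\mathcal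 J=\langle\theta,\ d\theta,\ (dp-F\,dy)\wedge dx\rangle_{\mathrm{alg}},\qquad \theta=dz-p\,dx-q\,dy,\qquad F=-\frac{2\sqrt{pq}}{x+y},$$ be the hyperbolic Monge–Ampère system that represents the Goursat equation $$(x+y)\,z_{xy}+2\sqrt{z_xz_y}=0 .$$ Then the hyperbolic Monge–Ampère system characterized by (1) and $\mathcal I_\sigma$ corresponds to this equation up to local contact equivalence: 1. If $(\sigma^i)$ is a coframing satisfying (1) on a $5$-dimensional smooth manifold $M$, then every point of $M$ has an open neighborhood $U$ with a diffeomorphism $\varphi$ from $U$ onto an open subset $V$ of $D$ such that $\varphi^*(\mathcal J|_V)=\mathcal I_\sigma|_U$. 2. Conversely, every point of $D$ has an open neighborhood $V\subseteq D$ carrying a coframing $(\tau^i)$ that satisfies (1) and has $\mathcal I_\tau=\mathcal J|_V$. -/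

import Mathlib

open scoped Manifold ContDiff

/-- The model space of 5-dimensional manifolds; it also serves as the jet space `J¹(ℝ², ℝ)`,
with coordinates `(x, y, z, p, q)` in this order. -/
abbrev R5 : Type := EuclideanSpace ℝ (Fin 5)

/-- Wedge product of alternating forms (sum over shuffles, so that
`(α ∧ β)(v, w) = α v * β w - α w * β v` for covectors). The degree of the result is any `n` with
a proof of `k + l = n`. -/
noncomputable def altWedge {V : Type*} [AddCommGroup V] [Module ℝ V] [TopologicalSpace V]
    {k l n : ℕ} (h : k + l = n) (a : V [⋀^Fin k]→L[ℝ] ℝ) (b : V [⋀^Fin l]→L[ℝ] ℝ) :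
    V [⋀^Fin n]→L[ℝ] ℝ where
  toAlternatingMap := ((LinearMap.mul' ℝ ℝ).compAlternatingMap
      (a.toAlternatingMap.domCoprod b.toAlternatingMap)).domDomCongr
        (finSumFinEquiv.trans (finCongr h))
  cont := by
    change Continuous fun v : Fin n → V => LinearMap.mul' ℝ ℝ
      ((∑ s : Equiv.Perm.ModSumCongr (Fin k) (Fin l),
        AlternatingMap.domCoprod.summand a.toAlternatingMap b.toAlternatingMap s)
          fun i => v ((finSumFinEquiv.trans (finCongr h)) i))
    simp only [sum_apply, map_sum]
    refine continuous_finsetSum _ fun s _ => ?_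
    induction s using Quotient.inductionOn' with
    | h s =>
      simp only [AlternatingMap.domCoprod.summand_mk'']
      have ha : Continuous fun v : Fin n → V =>
          a fun i => v (finCongr h (finSumFinEquiv (s (Sum.inl i)))) :=
        (show Continuous fun w : Fin k → V => a w from a.cont).comp (by fun_prop)
      have hb : Continuous fun v : Fin n → V =>
          b fun i => v (finCongr h (finSumFinEquiv (s (Sum.inr i)))) :=
        (show Continuous fun w : Fin l → V => b w from b.cont).comp (by fun_prop)
      rcases Int.units_eq_one_or (Equiv.Perm.sign s) with hs | hs <;> rw [hs]
      · rw [one_smul]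
        exact ha.mul hb
      · rw [Units.neg_smul, one_smul]
        simp only [neg_apply, map_neg]
        exact (ha.mul hb).neg

section Forms

variable {M : Type*} [TopologicalSpace M] [ChartedSpace R5 M]
variable {N : Type*} [TopologicalSpace N] [ChartedSpace R5 N]

/-- (Not necessarily smooth) differential forms of degree `k` on a 5-dimensional manifold. -/
abbrev Form (M : Type*) [TopologicalSpace M] [ChartedSpace R5 M] (k : ℕ) : Type _ :=
  (m : M) → TangentSpace 𝓘(ℝ, R5) m [⋀^Fin k]→L[ℝ] ℝ

/-- Pullback of a form along a map. -/
noncomputable def formPullback (φ : M → N) {k : ℕ} (β : Form N k) : Form M k :=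
  fun m => (β (φ m)).compContinuousLinearMap (mfderiv 𝓘(ℝ, R5) 𝓘(ℝ, R5) φ m)

/-- The expression of a form in the preferred chart at `m`, a form on (an open set of) `ℝ⁵`. -/
noncomputable def inChart {k : ℕ} (β : Form M k) (m : M) : R5 → R5 [⋀^Fin k]→L[ℝ] ℝ :=
  formPullback (chartAt R5 m).symm β

/-- `β` is smooth on the set `U`. -/
def SmoothFormOn {k : ℕ} (β : Form M k) (U : Set M) : Prop :=
  ∀ m ∈ U, ContDiffAt ℝ ∞ (inChart β m) (chartAt R5 m m)

/-- Exterior derivative, computed in a chart around each point. -/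
noncomputable def extD {k : ℕ} (β : Form M k) : Form M (k + 1) :=
  fun m => (extDeriv (inChart β m) (chartAt R5 m m)).compContinuousLinearMap
    (mfderiv 𝓘(ℝ, R5) 𝓘(ℝ, R5) (chartAt R5 m) m)

/-- Wedge product of forms. -/
noncomputable def formWedge {k l n : ℕ} (h : k + l = n) (α : Form M k) (β : Form M l) :
    Form M n :=
  fun m => altWedge (V := R5) h (α m) (β m)

/-- Wedge product of two 1-forms. -/
noncomputable def wedge₁ (α β : Form M 1) : Form M 2 := formWedge (rfl : 1 + 1 = 2) α β

infixl:75 " ⋏ " => wedge₁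

/-- `AlgIdeal S U β`: on `U`, the form `β` belongs to the (homogeneous, algebraic) ideal of the
exterior algebra of smooth forms on `U` generated by the set `S` of forms. Values of forms
outside `U` are irrelevant. -/
inductive AlgIdeal (S : Set (Σ k, Form M k)) (U : Set M) : {k : ℕ} → Form M k → Prop
  | of {k : ℕ} (β : Form M k) (hβ : ⟨k, β⟩ ∈ S) : AlgIdeal S U β
  | zero (k : ℕ) : AlgIdeal S U (0 : Form M k)
  | add {k : ℕ} (β η : Form M k) (hβ : AlgIdeal S U β) (hη : AlgIdeal S U η) :
      AlgIdeal S U (β + η)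
  | wedge {k l n : ℕ} (h : k + l = n) (α : Form M k) (β : Form M l) (hα : SmoothFormOn α U)
      (hβ : AlgIdeal S U β) : AlgIdeal S U (formWedge h α β)
  | congr {k : ℕ} (β η : Form M k) (hβ : AlgIdeal S U β) (h : ∀ m ∈ U, β m = η m) :
      AlgIdeal S U η

/-- The generators of a differential ideal: the given forms and their exterior derivatives.
The differential ideal generated by `S` is the algebraic ideal generated by `withDeriv S`. -/
def withDeriv (S : Set (Σ k, Form M k)) : Set (Σ k, Form M k) :=
  S ∪ {η | ∃ β ∈ S, η = ⟨β.1 + 1, extD β.2⟩}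

/-- The 1-forms `σ⁰, …, σ⁴` are a smooth coframing on `U`. -/
def IsCoframingOn (σ : Fin 5 → Form M 1) (U : Set M) : Prop :=
  (∀ i, SmoothFormOn (σ i) U) ∧ ∀ m ∈ U, LinearIndependent ℝ fun i => σ i m

/-- The structure equations, with parameter `ε`, for `σ⁰, …, σ⁴` on `U`. -/
def StructureEquationsOn (ε : ℝ) (σ : Fin 5 → Form M 1) (U : Set M) : Prop :=
  ∀ m ∈ U,
    extD (σ 0) m = ((-ε) • σ 0 ⋏ (σ 2 - σ 4) + σ 1 ⋏ σ 2 + σ 3 ⋏ σ 4) m ∧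
    extD (σ 1) m = (ε • σ 1 ⋏ (σ 2 + σ 3 + σ 4)) m ∧
    extD (σ 2) m = (σ 0 ⋏ (σ 2 - σ 4) - ε • (σ 1 - σ 3) ⋏ σ 2) m ∧
    extD (σ 3) m = ((-ε) • σ 3 ⋏ (σ 1 + σ 2 + σ 4)) m ∧
    extD (σ 4) m = (-(σ 0 ⋏ (σ 2 - σ 4)) - ε • (σ 1 - σ 3) ⋏ σ 4) m

/-- Generators of the differential ideal `⟨σ⁰, σ¹ ∧ σ², σ³ ∧ σ⁴⟩`. -/
def coframeGenerators (σ : Fin 5 → Form M 1) : Set (Σ k, Form M k) :=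
  withDeriv {⟨1, σ 0⟩, ⟨2, σ 1 ⋏ σ 2⟩, ⟨2, σ 3 ⋏ σ 4⟩}

/-- `φ` identifies the ideal generated by `S` on its source with the one generated by `T` on its
target: `φ^* 𝓙 = 𝓘`. For Monge-Ampère systems this is a (local) contact equivalence. -/
def IsContactEquivalence (φ : PartialDiffeomorph 𝓘(ℝ, R5) 𝓘(ℝ, R5) M N ∞)
    (S : Set (Σ k, Form M k)) (T : Set (Σ k, Form N k)) : Prop :=
  (∀ (k : ℕ) (β : Form N k), AlgIdeal T φ.target β →
    AlgIdeal S φ.source (formPullback φ.toFun β)) ∧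
  (∀ (k : ℕ) (η : Form M k), AlgIdeal S φ.source η →
    AlgIdeal T φ.target (formPullback φ.invFun η))

end Forms

/-- The coordinate 1-forms `dx, dy, dz, dp, dq` on `J¹(ℝ², ℝ)`, indexed by `0, …, 4`. -/
noncomputable def coordForm (i : Fin 5) : Form R5 1 :=
  fun _ => ContinuousAlternatingMap.ofSubsingleton ℝ R5 ℝ (0 : Fin 1) (EuclideanSpace.proj i)

/-- The canonical contact form `dz - p dx - q dy`. -/
noncomputable def contactForm : Form R5 1 :=
  fun u => coordForm 2 u - u 3 • coordForm 0 u - u 4 • coordForm 1 u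

/-- Generators of the algebraic ideal `⟨θ, dθ, (dp - F dy) ∧ dx⟩` on `J¹(ℝ², ℝ)` that represents
the equation `z_xy = F(x, y, z, z_x, z_y)`. -/
noncomputable def pdeGenerators (F : ℝ → ℝ → ℝ → ℝ → ℝ → ℝ) : Set (Σ k, Form R5 k) :=
  {⟨1, contactForm⟩, ⟨2, extD contactForm⟩,
   ⟨2, wedge₁ (fun u => coordForm 3 u - F (u 0) (u 1) (u 2) (u 3) (u 4) • coordForm 1 u)
      (coordForm 0)⟩}

/-- `(x + y) z_xy + 2 √(z_x z_y) = 0`, solved for `z_xy`. -/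
noncomputable def goursatRHS (x y _z p q : ℝ) : ℝ := -(2 * √(p * q)) / (x + y)

/-- The open part of `J¹(ℝ², ℝ)` on which the equation `(x + y) z_xy + 2 √(z_x z_y) = 0` can be
solved for `z_xy` and is smooth: `x + y ≠ 0` and `z_x z_y > 0`. -/
def goursatDomain : Set R5 := {u | u 0 + u 1 ≠ 0 ∧ 0 < u 3 * u 4}

/-! Equations (1) are Maurer–Cartan equations in disguise. Put `a = -ε σ¹`, `b = ε σ³`, `h =
-ε(σ¹+σ²+σ³+σ⁴)`, `κ = -2ε σ⁰+σ¹-σ²-σ³+σ⁴` and `δ = σ²-σ⁴`. Using `ε² = 1`, (1) yields `da = h∧a`,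
`db = -h∧b`, `dh = 2 a∧b`, `dκ = 0`, `dδ = -ε κ∧δ`, the structure equations of `sl₂` times the
nonabelian 2-dimensional Lie algebra. Hence all such coframings are locally alike, and it remains to
recognise the Goursat equation among them.

For the first claim the total differential systems given by 2-dimensional representations of the two
factors are flat, so they have local solutions (`exists_hasFDerivAt_of_flat`, `exists_sl2_solution`,
`exists_affine_solution`). Two solutions `(u₁,v₁)`, `(u₂,v₂)` with `u₁v₂ - u₂v₁ = 1` and a solution
`(r,w)` of `dr = ε r κ`, `dw = -ε r δ` give the coordinates `x = v₁/v₂`, `y = -u₁/u₂`, `z = w - r`,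
`p = r v₂²`, `q = r u₂²`. This map pulls the explicit coframing `goursatCoframe` back to the given
one (`exists_goursat_coordinates`). It is therefore a local diffeomorphism, and it matches the
ideals.

For the second claim `goursatCoframe` satisfies (1) on all of `D`
(`structureEquationsOn_goursatCoframe`), and its ideal is that of the equation, since each generator
of one is a combination, with smooth coefficients, of the generators of the other
(`algIdeal_goursatCoframe_iff`). -/

/-! ### Wedge products of alternating forms in low degree. -/

section AltWedge

variable {V : Type*} [AddCommGroup V] [Module ℝ V] [TopologicalSpace V]
variable {W : Type*} [AddCommGroup W] [Module ℝ W] [TopologicalSpace W]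

/-- Each shuffle class consists of `k! l!` permutations. Summing over all permutations replaces the
quotient in the definition of `altWedge` by a finite sum that can be computed. -/
theorem factorial_mul_altWedge_apply {k l n : ℕ} (h : k + l = n) (a : V [⋀^Fin k]→L[ℝ] ℝ)
    (b : V [⋀^Fin l]→L[ℝ] ℝ) (v : Fin n → V) :
    ((k.factorial * l.factorial : ℕ) : ℝ) * altWedge h a b v =
      ∑ σ : Equiv.Perm (Fin k ⊕ Fin l), ((Equiv.Perm.sign σ : ℤ) : ℝ) *
        (a (fun i => v (finCongr h (finSumFinEquiv (σ (Sum.inl i))))) *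
         b (fun i => v (finCongr h (finSumFinEquiv (σ (Sum.inr i)))))) := by
  have key := congrArg (fun f => LinearMap.mul' ℝ ℝ
      (f fun i => v ((finSumFinEquiv.trans (finCongr h)) i)))
    (MultilinearMap.domCoprod_alternization_eq a.toAlternatingMap b.toAlternatingMap)
  simp only [MultilinearMap.alternatization_apply, map_sum, AlternatingMap.smul_apply,
    Fintype.card_fin, map_nsmul] at key
  rw [nsmul_eq_mul] at key
  refine Eq.trans key.symm ?_
  refine Finset.sum_congr rfl fun σ _ => ?_
  rcases Int.units_eq_one_or (Equiv.Perm.sign σ) with hs | hs <;> rw [hs] <;> simp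

theorem altWedge_compContinuousLinearMap {k l n : ℕ} (h : k + l = n) (a : V [⋀^Fin k]→L[ℝ] ℝ)
    (b : V [⋀^Fin l]→L[ℝ] ℝ) (L : W →L[ℝ] V) :
    (altWedge h a b).compContinuousLinearMap L =
      altWedge h (a.compContinuousLinearMap L) (b.compContinuousLinearMap L) := by
  ext v
  have h0 : ((k.factorial * l.factorial : ℕ) : ℝ) ≠ 0 := by positivity
  apply mul_left_cancel₀ h0
  rw [ContinuousAlternatingMap.compContinuousLinearMap_apply, factorial_mul_altWedge_apply,
    factorial_mul_altWedge_apply]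
  rfl

theorem sum_perm_sum_fin {k l n : ℕ} (h : k + l = n) (f : Equiv.Perm (Fin n) → ℝ) :
    ∑ σ : Equiv.Perm (Fin k ⊕ Fin l), f ((finSumFinEquiv.trans (finCongr h)).permCongr σ) =
      ∑ σ, f σ :=
  Equiv.sum_comp (finSumFinEquiv.trans (finCongr h)).permCongr f

theorem factorial_mul_altWedge_apply' {k l n : ℕ} (h : k + l = n) (a : V [⋀^Fin k]→L[ℝ] ℝ)
    (b : V [⋀^Fin l]→L[ℝ] ℝ) (v : Fin n → V) :
    ((k.factorial * l.factorial : ℕ) : ℝ) * altWedge h a b v =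
      ∑ σ : Equiv.Perm (Fin n), ((Equiv.Perm.sign σ : ℤ) : ℝ) *
        (a (fun i => v (σ (finCongr h (Fin.castAdd l i)))) *
         b (fun i => v (σ (finCongr h (Fin.natAdd k i))))) := by
  rw [factorial_mul_altWedge_apply, ← sum_perm_sum_fin h]
  refine Finset.sum_congr rfl fun σ _ => ?_
  simp [Equiv.permCongr_apply, Equiv.Perm.sign_permCongr]

theorem altWedge_one_one (a b : V [⋀^Fin 1]→L[ℝ] ℝ) (v : Fin 2 → V) :
    altWedge (rfl : 1 + 1 = 2) a b v =
      a (fun _ => v 0) * b (fun _ => v 1) - a (fun _ => v 1) * b (fun _ => v 0) := by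
  have key := factorial_mul_altWedge_apply' (rfl : 1 + 1 = 2) a b v
  have e0 : ∀ σ : Equiv.Perm (Fin 2),
      (fun i : Fin 1 => v (σ (finCongr (rfl : 1 + 1 = 2) (Fin.natAdd 1 i)))) =
        fun _ => v (σ 1) := by
    intro σ; ext i; fin_cases i; rfl
  have e1 : ∀ σ : Equiv.Perm (Fin 2),
      (fun i : Fin 1 => v (σ (finCongr (rfl : 1 + 1 = 2) (Fin.castAdd 1 i)))) =
        fun _ => v (σ 0) := by
    intro σ; ext i; fin_cases i; rfl
  simp only [e0, e1] at key
  have hu : (Finset.univ : Finset (Equiv.Perm (Fin 2))) = {1, Equiv.swap 0 1} := by decide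
  have hp : (1 : Equiv.Perm (Fin 2)) ≠ Equiv.swap 0 1 := by decide
  rw [hu, Finset.sum_pair hp, Equiv.Perm.sign_swap (by decide)] at key
  simp at key
  rw [key]
  ring

theorem altWedge_one_two (a : V [⋀^Fin 1]→L[ℝ] ℝ) (b : V [⋀^Fin 2]→L[ℝ] ℝ) (v : Fin 3 → V) :
    altWedge (rfl : 1 + 2 = 3) a b v =
      a (fun _ => v 0) * b ![v 1, v 2] - a (fun _ => v 1) * b ![v 0, v 2] +
        a (fun _ => v 2) * b ![v 0, v 1] := by
  have key := factorial_mul_altWedge_apply' (rfl : 1 + 2 = 3) a b v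
  have e0 : ∀ σ : Equiv.Perm (Fin 3),
      (fun i : Fin 2 => v (σ (finCongr (rfl : 1 + 2 = 3) (Fin.natAdd 1 i)))) =
        ![v (σ 1), v (σ 2)] := by
    intro σ; ext i; fin_cases i <;> rfl
  have e1 : ∀ σ : Equiv.Perm (Fin 3),
      (fun i : Fin 1 => v (σ (finCongr (rfl : 1 + 2 = 3) (Fin.castAdd 2 i)))) =
        fun _ => v (σ 0) := by
    intro σ; ext i; fin_cases i; rfl
  simp only [e0, e1] at key
  have hu : (Finset.univ : Finset (Equiv.Perm (Fin 3))) =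
      {1, Equiv.swap 0 1, Equiv.swap 0 2, Equiv.swap 1 2, Equiv.swap 0 1 * Equiv.swap 1 2,
        Equiv.swap 1 2 * Equiv.swap 0 1} := by decide
  rw [hu, Finset.sum_insert (by decide), Finset.sum_insert (by decide),
    Finset.sum_insert (by decide), Finset.sum_insert (by decide),
    Finset.sum_pair (by decide)] at key
  have hs : ∀ x y : V, b ![x, y] = - b ![y, x] := by
    intro x y
    have := b.toAlternatingMap.map_swap ![y, x] (i := 0) (j := 1) (by decide)
    rw [← ContinuousAlternatingMap.coe_toAlternatingMap, ← this]
    congr 1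
    ext i; fin_cases i <;> rfl
  have t1 : Equiv.swap (0 : Fin 3) 1 2 = 2 := by decide
  have t2 : Equiv.swap (0 : Fin 3) 2 1 = 1 := by decide
  have t3 : Equiv.swap (1 : Fin 3) 2 0 = 0 := by decide
  simp only [Equiv.Perm.sign_mul, Equiv.Perm.sign_one, Equiv.Perm.coe_one, id_eq,
    Equiv.Perm.mul_apply, Equiv.swap_apply_left, Equiv.swap_apply_right, t1, t2, t3,
    Equiv.Perm.sign_swap (show (0 : Fin 3) ≠ 1 by decide),
    Equiv.Perm.sign_swap (show (0 : Fin 3) ≠ 2 by decide),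
    Equiv.Perm.sign_swap (show (1 : Fin 3) ≠ 2 by decide)] at key
  rw [hs (v 2) (v 1), hs (v 1) (v 0), hs (v 2) (v 0)] at key
  norm_num [Nat.factorial] at key
  linarith

theorem altWedge_zero_left {k : ℕ} (h : 0 + k = k) (a : V [⋀^Fin 0]→L[ℝ] ℝ)
    (b : V [⋀^Fin k]→L[ℝ] ℝ)  :
    altWedge h a b = a ![] • b := by
  ext v
  have h0 : ((Nat.factorial 0 * k.factorial : ℕ) : ℝ) ≠ 0 := by positivity
  apply mul_left_cancel₀ h0
  rw [factorial_mul_altWedge_apply']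
  have : ∀ σ : Equiv.Perm (Fin k), ((Equiv.Perm.sign σ : ℤ) : ℝ) *
        (a (fun i => v (σ (finCongr h (Fin.castAdd k i)))) *
         b (fun i => v (σ (finCongr h (Fin.natAdd 0 i))))) = a ![] * b v := by
    intro σ
    have h1 := b.toAlternatingMap.map_perm v σ
    have h2 : (fun i => v (σ (finCongr h (Fin.natAdd 0 i)))) = v ∘ σ := by
      ext i; simp
    have h3 : (fun i => v (σ (finCongr h (Fin.castAdd k i)))) = ![] := Subsingleton.elim _ _
    rw [h2, h3]
    rw [ContinuousAlternatingMap.coe_toAlternatingMap] at h1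
    rw [h1]
    rcases Int.units_eq_one_or (Equiv.Perm.sign σ) with hs | hs <;> rw [hs] <;> simp
  rw [Finset.sum_congr rfl fun σ _ => this σ]
  simp [Fintype.card_perm]

end AltWedge

/-! ### Linear ordinary differential equations on the unit interval. -/

section LinearODE

open Set Metric Filter Topology NNReal

/-- In the ball of radius `‖y₀‖` about `y₀` the speed is at most `1/2 * 2‖y₀‖ = ‖y₀‖`, so a solution
cannot leave the ball before time 1. This makes Picard–Lindelöf applicable on the whole interval. -/
theorem exists_linear_ode_solution {F : Type*} [NormedAddCommGroup F] [NormedSpace ℝ F]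
    [CompleteSpace F] {B : ℝ → F →L[ℝ] F} (hB : ContinuousOn B (Icc 0 1))
    (hb : ∀ t ∈ Icc (0 : ℝ) 1, ‖B t‖ ≤ 1 / 2) (y₀ : F) :
    ∃ y : ℝ → F, y 0 = y₀ ∧
      (∀ t ∈ Icc (0 : ℝ) 1, HasDerivWithinAt y (B t (y t)) (Icc 0 1) t) := by
  have hpl : IsPicardLindelof (fun t y => B t y) (⟨0, by simp⟩ : Icc (0 : ℝ) 1) y₀
      ‖y₀‖₊ 0 ‖y₀‖₊ 1 := by
    refine ⟨fun t ht => ?_, fun x _ => hB.clm_apply continuousOn_const, fun t ht x hx => ?_, ?_⟩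
    · refine LipschitzWith.lipschitzOnWith ?_
      refine (B t).lipschitz.weaken ?_
      have := hb t ht
      rw [← NNReal.coe_le_coe]
      simp; linarith
    · have h1 : ‖x‖ ≤ 2 * ‖y₀‖ := by
        rw [mem_closedBall, dist_eq_norm] at hx
        have := norm_le_norm_add_norm_sub' x y₀
        simp at hx
        linarith
      calc ‖B t x‖ ≤ ‖B t‖ * ‖x‖ := (B t).le_opNorm x
        _ ≤ 1 / 2 * (2 * ‖y₀‖) := by
          gcongr
          exact hb t ht
        _ = _ := by simp
    · simp
  exact hpl.exists_eq_forall_mem_Icc_hasDerivWithinAt₀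

theorem norm_solution_le {F : Type*} [NormedAddCommGroup F] [NormedSpace ℝ F]
    {B : ℝ → F →L[ℝ] F}
    (hb : ∀ t ∈ Icc (0 : ℝ) 1, ‖B t‖ ≤ 1) {y : ℝ → F} 
    (hy : ∀ t ∈ Icc (0 : ℝ) 1, HasDerivWithinAt y (B t (y t)) (Icc 0 1) t) :
    ∀ t ∈ Icc (0 : ℝ) 1, ‖y t‖ ≤ ‖y 0‖ * Real.exp 1 := by
  intro t ht
  have := norm_le_gronwallBound_of_norm_deriv_right_le (f := y) (f' := fun t => B t (y t))
    (δ := ‖y 0‖) (K := 1) (ε := 0) (a := 0) (b := 1)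
    (fun t ht => (hy t ht).continuousWithinAt)
    (fun t ht => ((hy t ⟨ht.1, ht.2.le⟩).mono_of_mem_nhdsWithin (Icc_mem_nhdsGE_of_mem ht)))
    le_rfl (fun t ht => by
      have h1 := (B t).le_opNorm (y t)
      have h2 := hb t ⟨ht.1, ht.2.le⟩
      nlinarith [norm_nonneg (y t)]) t ht
  rw [gronwallBound_ε0] at this
  refine this.trans ?_
  gcongr
  simpa using ht.2

/-- Grönwall's inequality for a solution `y` and an approximate solution `z` with defect at most
`e`. -/
theorem dist_solution_le {F : Type*} [NormedAddCommGroup F] [NormedSpace ℝ F]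
    {B : ℝ → F →L[ℝ] F} (hb : ∀ t ∈ Icc (0 : ℝ) 1, ‖B t‖ ≤ 1) {y z z' : ℝ → F} {e : ℝ}
    (hy : ∀ t ∈ Icc (0 : ℝ) 1, HasDerivWithinAt y (B t (y t)) (Icc 0 1) t)
    (hz : ∀ t ∈ Icc (0 : ℝ) 1, HasDerivWithinAt z (z' t) (Icc 0 1) t)
    (he : ∀ t ∈ Icc (0 : ℝ) 1, ‖z' t - B t (z t)‖ ≤ e) (h0 : y 0 = z 0) :
    ‖y 1 - z 1‖ ≤ e * Real.exp 1 := by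
  have := dist_le_of_approx_trajectories_ODE_of_mem (v := fun t y => B t y) (K := 1)
    (s := fun _ => univ) (a := 0) (b := 1) (f := y) (g := z) (f' := fun t => B t (y t)) (g' := z')
    (εf := 0) (εg := e) (δ := 0)
    (fun t ht => ((B t).lipschitz.weaken (by
      rw [← NNReal.coe_le_coe]; simpa using hb t ⟨ht.1, ht.2.le⟩)).lipschitzOnWith)
    (fun t ht => (hy t ht).continuousWithinAt)
    (fun t ht => ((hy t ⟨ht.1, ht.2.le⟩).mono_of_mem_nhdsWithin (Icc_mem_nhdsGE_of_mem ht)))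
    (fun t _ => by simp) (fun _ _ => trivial)
    (fun t ht => (hz t ht).continuousWithinAt)
    (fun t ht => ((hz t ⟨ht.1, ht.2.le⟩).mono_of_mem_nhdsWithin (Icc_mem_nhdsGE_of_mem ht)))
    (fun t ht => by simpa [dist_eq_norm] using he t ⟨ht.1, ht.2.le⟩) (fun _ _ => trivial)
    (by simp [h0]) 1 (by simp)
  rw [dist_eq_norm, gronwallBound_of_K_ne_0 (by simp)] at this
  have h2 : 0 ≤ e := (norm_nonneg _).trans (he 0 (by simp))
  simp at this
  nlinarith

end LinearODE

/-! ### Parallel sections of flat connections, by integration along rays. -/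

section FlatConnection

open Set Metric Filter Topology NNReal

set_option synthInstance.maxHeartbeats 200000
set_option maxSynthPendingDepth 5

variable {E : Type*} [NormedAddCommGroup E] [NormedSpace ℝ E]

theorem norm_image_sub_sub_le_of_lipschitzOn_fderiv {G : Type*} [NormedAddCommGroup G]
    [NormedSpace ℝ G] {A : E → G} {s : Set E} (hs : Convex ℝ s) {L : ℝ≥0}
    (hA : ∀ x ∈ s, DifferentiableAt ℝ A x) (hL : LipschitzOnWith L (fderiv ℝ A) s) {x h : E}
    (hx : x ∈ s) (hxh : x + h ∈ s) : ‖A (x + h) - A x - fderiv ℝ A x h‖ ≤ L * ‖h‖ ^ 2 := by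
  have hseg : segment ℝ x (x + h) ⊆ s := hs.segment_subset hx hxh
  have := (convex_segment x (x + h)).norm_image_sub_le_of_norm_hasFDerivWithin_le'
    (f := A) (f' := fderiv ℝ A) (φ := fderiv ℝ A x) (C := L * ‖h‖)
    (fun z hz => (hA z (hseg hz)).hasFDerivAt.hasFDerivWithinAt)
    (fun z hz => by
      refine (hL.norm_sub_le (hseg hz) hx).trans ?_
      gcongr
      obtain ⟨θ, hθ, rfl⟩ := (segment_eq_image' ℝ x (x + h) ▸ hz : z ∈ _)
      simp only [add_sub_cancel_left, norm_smul, Real.norm_eq_abs, abs_of_nonneg hθ.1]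
      exact mul_le_of_le_one_left (norm_nonneg _) hθ.2)
    (left_mem_segment ℝ x (x + h)) (right_mem_segment ℝ x (x + h))
  simp only [add_sub_cancel_left] at this
  nlinarith

variable {F : Type*} [NormedAddCommGroup F] [NormedSpace ℝ F]

/-- Here `a` and `d` stand for `A` and its derivative at the point `x₀ + t u` of a ray, and `b` for
`A` at `x₀ + t (u + h)`. If `y` solves the equation along the ray of direction `u`, then `y + t A(h)
y` is a trial solution along the ray of direction `u + h`. The estimate bounds its defect; flatness
is what removes the terms of first order in `h`. -/
theorem radial_variation_defect {a : E →L[ℝ] F →L[ℝ] F} {d : E →L[ℝ] E →L[ℝ] F →L[ℝ] F}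
    {b : E →L[ℝ] F →L[ℝ] F} {u h : E} {y : F} {t C L Y : ℝ} (ht : t ∈ Icc (0 : ℝ) 1)
    (hflat : d u h - d h u = (a u).comp (a h) - (a h).comp (a u))
    (ha : ‖a‖ ≤ C) (hd : ‖d‖ ≤ C) (hb : ‖b - a - t • d h‖ ≤ L * ‖h‖ ^ 2) (hy : ‖y‖ ≤ Y)
    (hh : ‖h‖ ≤ 1) (huh : ‖u + h‖ ≤ 1) :
    ‖(a u y + a h y + t • (d u h y + a h (a u y))) - b (u + h) (y + t • a h y)‖ ≤
      (2 * C ^ 2 + C + L * (1 + C)) * Y * ‖h‖ ^ 2 := by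
  have hC : 0 ≤ C := (norm_nonneg _).trans ha
  have hY : 0 ≤ Y := (norm_nonneg _).trans hy
  obtain ⟨r, hr⟩ : ∃ r, r = b - a - t • d h := ⟨_, rfl⟩
  have hb' : b = a + t • d h + r := by rw [hr]; abel
  rw [← hr] at hb
  have hf : d u h y - d h u y = a u (a h y) - a h (a u y) := by
    simpa using congrArg (fun T : F →L[ℝ] F => T y) hflat
  -- After exchanging `d u h` for `d h u` plus the commutator, each remaining term is quadratic in
  -- `h` or contains the Taylor remainder `r`.
  have e : (a u y + a h y + t • (d u h y + a h (a u y))) - b (u + h) (y + t • a h y) =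
      - (t • (a h (a h y)) + t • (d h h y) + t • t • (d h (u + h) (a h y)) +
        r (u + h) (y + t • a h y)) := by
    have hf' : d u h y = d h u y + (a u (a h y) - a h (a u y)) := by rw [← hf]; abel
    rw [hb', hf']
    simp only [map_add, add_apply, smul_apply, smul_add, smul_sub, map_smul]
    abel
  have hah : ‖a h y‖ ≤ C * ‖h‖ * Y := (a.le_opNorm₂ h y).trans (by gcongr)
  have habs : |t| ≤ 1 := by rw [abs_of_nonneg ht.1]; exact ht.2
  have hts : ∀ z : F, ‖t • z‖ ≤ ‖z‖ := fun z => by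
    rw [norm_smul]; exact mul_le_of_le_one_left (norm_nonneg _) habs
  have h1 : ‖t • a h (a h y)‖ ≤ C ^ 2 * Y * ‖h‖ ^ 2 := by
    refine (hts _).trans ((a.le_opNorm₂ h _).trans ?_)
    calc ‖a‖ * ‖h‖ * ‖a h y‖ ≤ C * ‖h‖ * (C * ‖h‖ * Y) := by gcongr
      _ = _ := by ring
  have h2 : ‖t • d h h y‖ ≤ C * Y * ‖h‖ ^ 2 := by
    refine (hts _).trans (((d h).le_opNorm₂ h _).trans ?_)
    calc ‖d h‖ * ‖h‖ * ‖y‖ ≤ (C * ‖h‖) * ‖h‖ * Y := by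
          gcongr; exact d.le_of_opNorm_le hd h
      _ = _ := by ring
  have h3 : ‖t • t • d h (u + h) (a h y)‖ ≤ C ^ 2 * Y * ‖h‖ ^ 2 := by
    refine (hts _).trans ((hts _).trans (((d h).le_opNorm₂ _ _).trans ?_))
    calc ‖d h‖ * ‖u + h‖ * ‖a h y‖ ≤ (C * ‖h‖) * 1 * (C * ‖h‖ * Y) := by
          gcongr; exact d.le_of_opNorm_le hd h
      _ = _ := by ring
  have h4 : ‖r (u + h) (y + t • a h y)‖ ≤ L * (1 + C) * Y * ‖h‖ ^ 2 := by
    have h5 : ‖y + t • a h y‖ ≤ (1 + C) * Y := by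
      refine (norm_add_le _ _).trans ?_
      have : C * ‖h‖ * Y ≤ C * 1 * Y := by gcongr
      linarith [hts (a h y)]
    refine (r.le_opNorm₂ _ _).trans ?_
    calc ‖r‖ * ‖u + h‖ * ‖y + t • a h y‖ ≤ (L * ‖h‖ ^ 2) * 1 * ((1 + C) * Y) := by
          gcongr <;> simpa using (norm_nonneg _).trans hb
      _ = _ := by ring
  rw [e, norm_neg]
  refine (norm_add_le _ _).trans ?_
  have h5 := norm_add₃_le (a := t • a h (a h y)) (b := t • d h h y)
    (c := t • t • d h (u + h) (a h y))
  linarith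

/-- Bootstrapping: the derivative of `Y` is a smooth expression in `A` and `Y`, so it is as regular
as `Y` itself. -/
theorem contDiffAt_of_hasFDerivAt_flat {A : E → E →L[ℝ] F →L[ℝ] F} {Y : E → F} {x₀ : E}
    (hA : ContDiffAt ℝ ∞ A x₀)
    (hY : ∀ᶠ x in 𝓝 x₀, HasFDerivAt Y ((A x).flip (Y x)) x) : ContDiffAt ℝ ∞ Y x₀ := by
  rw [contDiffAt_infty]
  intro n
  induction n with
  | zero =>
    rw [Nat.cast_zero, contDiffAt_zero]
    obtain ⟨u, hu, hx⟩ := eventually_iff_exists_mem.1 hY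
    exact ⟨u, hu, fun x h => (hx x h).continuousAt.continuousWithinAt⟩
  | succ n ih =>
    have h1 : fderiv ℝ Y =ᶠ[𝓝 x₀] fun x => (A x).flip (Y x) := hY.mono fun x hx => hx.fderiv
    rw [Nat.cast_succ, contDiffAt_succ_iff_hasFDerivAt]
    obtain ⟨u, hu, hx⟩ := eventually_iff_exists_mem.1 hY
    refine ⟨fun x => (A x).flip (Y x), ⟨u, hu, hx⟩, ?_⟩
    have h2 : ContDiffAt ℝ n (fun x => (A x).flip) x₀ :=
      (ContinuousLinearMap.flipₗᵢ ℝ E F F).contDiff.contDiffAt.comp x₀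
        (hA.of_le (WithTop.coe_le_coe.2 le_top))
    exact h2.clm_apply ih

variable [CompleteSpace F]

/-- The equation `dY = A Y` is solved along each ray from `x₀`, and `Y (x₀ + u)` is the value at
time 1 on the ray of direction `u`. To differentiate in `u`, the solution for `u + h` is compared
with the trial curve of `radial_variation_defect`; Grönwall turns its defect of order `‖h‖²` into a
remainder of that order. -/
theorem exists_hasFDerivAt_of_flat {A : E → E →L[ℝ] F →L[ℝ] F} {x₀ : E}
    (hA : ∀ᶠ x in 𝓝 x₀, ContDiffAt ℝ 2 A x)
    (hflat : ∀ᶠ x in 𝓝 x₀, ∀ v w, fderiv ℝ A x v w - fderiv ℝ A x w v =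
      (A x v).comp (A x w) - (A x w).comp (A x v)) (y₀ : F) :
    ∃ Y : E → F, Y x₀ = y₀ ∧ ∀ᶠ x in 𝓝 x₀, HasFDerivAt Y ((A x).flip (Y x)) x := by
  have hA0 := hA.self_of_nhds
  have hdA : ContDiffAt ℝ 1 (fderiv ℝ A) x₀ := hA0.fderiv_right (by norm_num)
  obtain ⟨L, s, hs, hL⟩ := hdA.exists_lipschitzOnWith
  obtain ⟨C, hC0, hC⟩ : ∃ C : ℝ, 0 ≤ C ∧ ∀ᶠ x in 𝓝 x₀, ‖A x‖ ≤ C ∧ ‖fderiv ℝ A x‖ ≤ C := by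
    refine ⟨max (‖A x₀‖ + 1) (‖fderiv ℝ A x₀‖ + 1), by positivity, ?_⟩
    have h1 := hA0.continuousAt.norm.eventually (gt_mem_nhds (lt_add_one _))
    have h2 := hdA.continuousAt.norm.eventually (gt_mem_nhds (lt_add_one _))
    filter_upwards [h1, h2] with x h1 h2
    exact ⟨h1.le.trans (le_max_left _ _), h2.le.trans (le_max_right _ _)⟩
  obtain ⟨ρ, hρ, hball⟩ := Metric.eventually_nhds_iff_ball.1 (hA.and (hflat.and (hC.and hs)))
  -- `C * δ ≤ 1/2` gives the bound on the coefficient required by `exists_linear_ode_solution`; `δ ≤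
  -- 1/2` ensures `‖u + h‖ ≤ 1`.
  obtain ⟨δ, hδ, hδρ, hδ1, hδC⟩ : ∃ δ : ℝ, 0 < δ ∧ δ ≤ ρ ∧ δ ≤ 1 / 2 ∧ C * δ ≤ 1 / 2 := by
    refine ⟨min ρ (min (1 / 2) (1 / (2 * (C + 1)))), by positivity, min_le_left _ _,
      (min_le_right _ _).trans (min_le_left _ _), ?_⟩
    have : min ρ (min (1 / 2) (1 / (2 * (C + 1)))) ≤ 1 / (2 * (C + 1)) :=
      (min_le_right _ _).trans (min_le_right _ _)
    calc _ ≤ (C + 1) * (1 / (2 * (C + 1))) := by gcongr; linarith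
      _ = 1 / 2 := by field_simp
  have hmem : ∀ u : E, ‖u‖ < δ → ∀ t ∈ Icc (0 : ℝ) 1, x₀ + t • u ∈ ball x₀ ρ := by
    intro u hu t ht
    rw [mem_ball, dist_eq_norm, add_sub_cancel_left, norm_smul, Real.norm_eq_abs,
      abs_of_nonneg ht.1]
    nlinarith [norm_nonneg u, ht.2]
  have hB : ∀ u : E, ‖u‖ < δ → ∀ t ∈ Icc (0 : ℝ) 1, ‖A (x₀ + t • u) u‖ ≤ 1 / 2 := by
    intro u hu t ht
    refine ((A (x₀ + t • u)).le_of_opNorm_le (hball _ (hmem u hu t ht)).2.2.1.1 u).trans ?_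
    nlinarith
  have hray : ∀ u t, HasDerivAt (fun t : ℝ => x₀ + t • u) u t := fun u t => by
    simpa using ((hasDerivAt_id t).smul_const u).const_add x₀
  have hex : ∀ u : E, ∃ y : ℝ → F, ‖u‖ < δ → y 0 = y₀ ∧ ∀ t ∈ Icc (0 : ℝ) 1,
      HasDerivWithinAt y (A (x₀ + t • u) u (y t)) (Icc 0 1) t := by
    intro u
    by_cases hu : ‖u‖ < δ
    · obtain ⟨y, hy⟩ := exists_linear_ode_solution (B := fun t => A (x₀ + t • u) u)
        (fun t ht => by
          have h1 := (hball _ (hmem u hu t ht)).1.continuousAt.comp_of_eq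
            (hray u t).continuousAt rfl
          exact (h1.clm_apply continuousAt_const).continuousWithinAt) (hB u hu) y₀
      exact ⟨y, fun _ => hy⟩
    · exact ⟨0, fun h => absurd h hu⟩
  choose y hy using hex
  refine ⟨fun x => y (x - x₀) 1, ?_, ?_⟩
  · have h0 := hy 0 (by simpa using hδ)
    -- On the degenerate ray the coefficient vanishes, so the solution agrees with the constant
    -- `y₀`.
    have := dist_solution_le (B := fun t => A (x₀ + t • (0 : E)) 0) (by simp) (e := 0)
      h0.2 (z := fun _ => y₀) (z' := fun _ => 0) (fun t _ => hasDerivWithinAt_const _ _ _)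
      (by simp) h0.1
    simp only [zero_mul, norm_le_zero_iff, sub_eq_zero] at this
    simpa using this
  · filter_upwards [ball_mem_nhds x₀ hδ] with x hx
    obtain ⟨u, rfl⟩ : ∃ u, x = x₀ + u := ⟨x - x₀, by abel⟩
    have hu : ‖u‖ < δ := by simpa [dist_eq_norm] using hx
    rw [hasFDerivAt_iff_isLittleO_nhds_zero]
    refine Asymptotics.IsBigO.trans_isLittleO (g := fun h : E => ‖h‖ ^ 2) ?_
      (Asymptotics.isLittleO_norm_pow_id one_lt_two)
    have hev : ∀ᶠ h in 𝓝 (0 : E), ‖u + h‖ < δ ∧ ‖h‖ < 1 := by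
      refine ((continuous_const.add continuous_id).norm.tendsto' 0 ‖u‖ (by simp)
        |>.eventually (gt_mem_nhds hu)).and ?_
      exact continuous_norm.tendsto' (0 : E) 0 (by simp) |>.eventually (gt_mem_nhds one_pos)
    refine Asymptotics.IsBigO.of_bound
      ((2 * C ^ 2 + C + L * (1 + C)) * (‖y₀‖ * Real.exp 1) * Real.exp 1) ?_
    filter_upwards [hev] with h hh
    obtain ⟨hy0, hyd⟩ := hy u hu
    obtain ⟨hz0, hzd⟩ := hy (u + h) hh.1
    have hbd : ∀ t ∈ Icc (0 : ℝ) 1, ‖y u t‖ ≤ ‖y₀‖ * Real.exp 1 := by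
      have := norm_solution_le (B := fun t => A (x₀ + t • u) u)
        (fun t ht => (hB u hu t ht).trans (by norm_num)) hyd
      rwa [hy0] at this
    have key := dist_solution_le (B := fun t => A (x₀ + t • (u + h)) (u + h))
      (fun t ht => (hB (u + h) hh.1 t ht).trans (by norm_num)) hzd
      (z := fun t => y u t + t • A (x₀ + t • u) h (y u t))
      (z' := fun t => A (x₀ + t • u) u (y u t) + A (x₀ + t • u) h (y u t) +
        t • (fderiv ℝ A (x₀ + t • u) u h (y u t) +
          A (x₀ + t • u) h (A (x₀ + t • u) u (y u t))))
      (e := (2 * C ^ 2 + C + L * (1 + C)) * (‖y₀‖ * Real.exp 1) * ‖h‖ ^ 2)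
      (fun t ht => by
        have h1 : HasDerivAt (fun t => A (x₀ + t • u)) (fderiv ℝ A (x₀ + t • u) u) t :=
          ((hball _ (hmem u hu t ht)).1.differentiableAt (by norm_num)).hasFDerivAt.comp_hasDerivAt
            t (hray u t)
        have h2 := ((h1.clm_apply (hasDerivAt_const t h)).hasDerivWithinAt
          (s := Icc 0 1)).clm_apply (hyd t ht)
        have h3 := (hyd t ht).add ((hasDerivWithinAt_id t (Icc 0 1)).smul h2)
        refine h3.congr_deriv ?_
        simp
        abel)
      (fun t ht => by
        have hm := hball _ (hmem u hu t ht)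
        have hm' := hmem (u + h) hh.1 t ht
        refine radial_variation_defect ht (hm.2.1 u h) hm.2.2.1.1 hm.2.2.1.2 ?_ (hbd t ht)
          hh.2.le (by linarith [hh.1])
        have hq := norm_image_sub_sub_le_of_lipschitzOn_fderiv (convex_ball x₀ ρ)
          (fun z hz => (hball z hz).1.differentiableAt (by norm_num))
          (hL.mono fun z hz => (hball z hz).2.2.2) (hmem u hu t ht) (h := t • h)
          (by simpa [smul_add, add_assoc] using hm')
        rw [smul_add, ← add_assoc, ← map_smul]
        refine hq.trans ?_
        gcongr
        rw [norm_smul, Real.norm_eq_abs, abs_of_nonneg ht.1]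
        exact mul_le_of_le_one_left (norm_nonneg _) ht.2)
      (by simp [hy0, hz0])
    simp only [one_smul] at key
    have e1 : x₀ + u + h - x₀ = u + h := by abel
    have e2 : x₀ + u - x₀ = u := by abel
    rw [e1, e2, ContinuousLinearMap.flip_apply, sub_sub]
    refine key.trans (le_of_eq ?_)
    simp
    ring

end FlatConnection

/-! ### Smoothness, pullback and exterior derivative of forms in charts. -/

section PullbackForms

open Set Filter Topology

/-- Evaluation on tuples of basis vectors is an injective linear map into a finite-dimensional
space. It has a linear, hence continuous, left inverse, through which smoothness of the components
passes to the form. -/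
theorem contDiffAt_continuousAlternatingMap_iff {X : Type*} [NormedAddCommGroup X]
    [NormedSpace ℝ X] {k : ℕ} {n : WithTop ℕ∞} {η : X → R5 [⋀^Fin k]→L[ℝ] ℝ} {x : X} :
    ContDiffAt ℝ n η x ↔
      ∀ r : Fin k → Fin 5, ContDiffAt ℝ n
        (fun y => η y fun i => EuclideanSpace.basisFun (Fin 5) ℝ (r i)) x := by
  let ev : (R5 [⋀^Fin k]→L[ℝ] ℝ) →L[ℝ] ((Fin k → Fin 5) → ℝ) :=
    ContinuousLinearMap.pi fun r => ContinuousAlternatingMap.apply ℝ R5 ℝ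
      fun i => EuclideanSpace.basisFun (Fin 5) ℝ (r i)
  constructor
  · intro h r
    exact (ContinuousAlternatingMap.apply ℝ R5 ℝ
      fun i => EuclideanSpace.basisFun (Fin 5) ℝ (r i)).contDiff.contDiffAt.comp x h
  · intro h
    have hinj : Function.Injective ev := by
      intro a b hab
      apply ContinuousAlternatingMap.toAlternatingMap_injective
      refine (EuclideanSpace.basisFun (Fin 5) ℝ).toBasis.ext_alternating fun r _ => ?_
      simpa [ev] using congrFun hab r
    obtain ⟨g, hg⟩ := ev.toLinearMap.exists_leftInverse_of_injective
      (LinearMap.ker_eq_bot.2 hinj)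
    have h1 : ContDiffAt ℝ n (fun y => ev (η y)) x := contDiffAt_pi.2 h
    have h2 : η = fun y => g.toContinuousLinearMap (ev (η y)) := by
      ext1 y
      exact (LinearMap.congr_fun hg (η y)).symm
    rw [h2]
    exact g.toContinuousLinearMap.contDiff.contDiffAt.comp x h1

theorem ContDiffAt.continuousAlternatingMap_apply {X : Type*} [NormedAddCommGroup X]
    [NormedSpace ℝ X] {k : ℕ} {n : WithTop ℕ∞} {η : X → R5 [⋀^Fin k]→L[ℝ] ℝ} {x : X}
    {v : X → Fin k → R5} (hη : ContDiffAt ℝ n η x) (hv : ∀ i, ContDiffAt ℝ n (fun y => v y i) x) :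
    ContDiffAt ℝ n (fun y => η y (v y)) x := by
  have h : (fun y => η y (v y)) = fun y => ∑ r : Fin k → Fin 5, (∏ i, v y i (r i)) *
      η y fun i => EuclideanSpace.basisFun (Fin 5) ℝ (r i) := by
    ext1 y
    have h1 : v y = fun i => ∑ j, v y i j • EuclideanSpace.basisFun (Fin 5) ℝ j := by
      ext1 i
      exact ((EuclideanSpace.basisFun (Fin 5) ℝ).sum_repr (v y i)).symm
    conv_lhs => rw [h1]
    rw [ContinuousAlternatingMap.map_sum]
    refine Finset.sum_congr rfl fun r _ => ?_
    rw [ContinuousAlternatingMap.map_smul_univ, smul_eq_mul]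
  rw [h]
  refine ContDiffAt.sum fun r _ => ContDiffAt.mul ?_ ?_
  · refine contDiffAt_prod fun i _ => ?_
    exact (EuclideanSpace.proj (r i) : R5 →L[ℝ] ℝ).contDiff.contDiffAt.comp
      x (hv i)
  · exact contDiffAt_continuousAlternatingMap_iff.1 hη r

theorem ContDiffAt.continuousAlternatingMap_compContinuousLinearMap {X : Type*}
    [NormedAddCommGroup X] [NormedSpace ℝ X] {k : ℕ} {n : WithTop ℕ∞}
    {η : X → R5 [⋀^Fin k]→L[ℝ] ℝ} {L : X → R5 →L[ℝ] R5} {x : X} (hη : ContDiffAt ℝ n η x)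
    (hL : ContDiffAt ℝ n L x) :
    ContDiffAt ℝ n (fun y => (η y).compContinuousLinearMap (L y)) x :=
  contDiffAt_continuousAlternatingMap_iff.2 fun _ =>
    hη.continuousAlternatingMap_apply fun _ => hL.clm_apply contDiffAt_const

variable {M : Type*} [TopologicalSpace M] [ChartedSpace R5 M]
variable {N : Type*} [TopologicalSpace N] [ChartedSpace R5 N]
variable {P : Type*} [TopologicalSpace P] [ChartedSpace R5 P]

theorem formPullback_congr {k : ℕ} {φ ψ : M → N} (β : Form N k) {m : M} (h : φ =ᶠ[𝓝 m] ψ) :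
    formPullback φ β m = formPullback ψ β m := by
  -- Forgetting the dependence of the tangent spaces on the base point allows the point and the
  -- derivative to be rewritten separately.
  let g : N → (R5 →L[ℝ] R5) → R5 [⋀^Fin k]→L[ℝ] ℝ := fun n L =>
    ContinuousAlternatingMap.compContinuousLinearMap (M := R5) (β n) L
  have h1 : (mfderiv 𝓘(ℝ, R5) 𝓘(ℝ, R5) φ m : R5 →L[ℝ] R5) = mfderiv 𝓘(ℝ, R5) 𝓘(ℝ, R5) ψ m :=
    h.mfderiv_eq
  change g (φ m) (mfderiv 𝓘(ℝ, R5) 𝓘(ℝ, R5) φ m) = g (ψ m) (mfderiv 𝓘(ℝ, R5) 𝓘(ℝ, R5) ψ m)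
  rw [h1, h.self_of_nhds]

theorem formPullback_comp {k : ℕ} {φ : M → N} {ψ : N → P} (β : Form P k) {m : M}
    (hφ : MDifferentiableAt 𝓘(ℝ, R5) 𝓘(ℝ, R5) φ m)
    (hψ : MDifferentiableAt 𝓘(ℝ, R5) 𝓘(ℝ, R5) ψ (φ m)) :
    formPullback (ψ ∘ φ) β m = formPullback φ (formPullback ψ β) m := by
  unfold formPullback
  rw [mfderiv_comp m hψ hφ]
  rfl

theorem formPullback_id {k : ℕ} (β : Form M k) : formPullback id β = β := by
  ext1 m
  unfold formPullback
  rw [mfderiv_id]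
  rfl

/-- Pullback of forms on `ℝ⁵`, in terms of the Fréchet derivative. -/
noncomputable def euclPullback {k : ℕ} (f : R5 → R5) (β : R5 → R5 [⋀^Fin k]→L[ℝ] ℝ) :
    R5 → R5 [⋀^Fin k]→L[ℝ] ℝ :=
  fun x => (β (f x)).compContinuousLinearMap (fderiv ℝ f x)

theorem formPullback_eq_euclPullback {k : ℕ} (f : R5 → R5) (β : Form R5 k) :
    formPullback f β = euclPullback f β := by
  ext1 x
  unfold formPullback
  rw [mfderiv_eq_fderiv]
  rfl

theorem formPullback_wedge {k l n : ℕ} (h : k + l = n) (φ : M → N) (α : Form N k)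
    (β : Form N l) :
    formPullback φ (formWedge h α β) = formWedge h (formPullback φ α) (formPullback φ β) := by
  ext1 m
  exact altWedge_compContinuousLinearMap (V := R5) (W := R5) h _ _ _

theorem contDiffAt_euclPullback {k : ℕ} {f : R5 → R5} {β : R5 → R5 [⋀^Fin k]→L[ℝ] ℝ} {x : R5}
    (hf : ContDiffAt ℝ ∞ f x) (hβ : ContDiffAt ℝ ∞ β (f x)) :
    ContDiffAt ℝ ∞ (euclPullback f β) x :=
  ContDiffAt.continuousAlternatingMap_compContinuousLinearMap (hβ.comp x hf)
    (hf.fderiv_right (by simp))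

theorem inChart_self {k : ℕ} (β : Form R5 k) (m : R5) : inChart β m = β := by
  unfold inChart
  rw [chartAt_self_eq]
  exact formPullback_id β

theorem extD_self {k : ℕ} (β : Form R5 k) (m : R5) :
    extD β m = extDeriv (F := ℝ) (E := R5) β m := by
  unfold extD
  rw [inChart_self, chartAt_self_eq]
  have : mfderiv 𝓘(ℝ, R5) 𝓘(ℝ, R5) (OpenPartialHomeomorph.refl R5) m =
    ContinuousLinearMap.id ℝ R5 := mfderiv_id
  rw [this]
  rfl

theorem smoothFormOn_self {k : ℕ} {β : Form R5 k} {U : Set R5} :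
    SmoothFormOn β U ↔ ∀ x ∈ U, ContDiffAt ℝ ∞ (E := R5) (F := R5 [⋀^Fin k]→L[ℝ] ℝ) β x := by
  unfold SmoothFormOn
  refine forall₂_congr fun m _ => ?_
  rw [inChart_self, chartAt_self_eq]
  rfl

variable [IsManifold 𝓘(ℝ, R5) ∞ M] [IsManifold 𝓘(ℝ, R5) ∞ N]

theorem mdifferentiableAt_chartAt {m m' : M} (h : m' ∈ (chartAt R5 m).source) :
    MDifferentiableAt 𝓘(ℝ, R5) 𝓘(ℝ, R5) (chartAt R5 m) m' :=
  ((contMDiffOn_chart (n := ∞)).contMDiffAt ((chartAt R5 m).open_source.mem_nhds h)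
    ).mdifferentiableAt (by simp)

theorem mdifferentiableAt_chartAt_symm {m : M} {y : R5} (h : y ∈ (chartAt R5 m).target) :
    MDifferentiableAt 𝓘(ℝ, R5) 𝓘(ℝ, R5) (chartAt R5 m).symm y :=
  ((contMDiffOn_chart_symm (n := ∞)).contMDiffAt ((chartAt R5 m).open_target.mem_nhds h)
    ).mdifferentiableAt (by simp)

/-- The expression of a pulled back form in charts. -/
theorem inChart_formPullback_eventuallyEq {k : ℕ} {φ : M → N} (β : Form N k) {m m' : M} {n : N}
    (hm : m' ∈ (chartAt R5 m).source) (hn : φ m' ∈ (chartAt R5 n).source)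
    (hφ : ∀ᶠ z in 𝓝 m', ContMDiffAt 𝓘(ℝ, R5) 𝓘(ℝ, R5) ∞ φ z) :
    inChart (formPullback φ β) m =ᶠ[𝓝 (chartAt R5 m m')]
      euclPullback (chartAt R5 n ∘ φ ∘ (chartAt R5 m).symm) (inChart β n) := by
  have hc : Tendsto (chartAt R5 m).symm (𝓝 (chartAt R5 m m')) (𝓝 m') :=
    (chartAt R5 m).tendsto_symm hm
  have h1 : ∀ᶠ z in 𝓝 m', φ z ∈ (chartAt R5 n).source :=
    hφ.self_of_nhds.continuousAt.eventually ((chartAt R5 n).open_source.mem_nhds hn)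
  have ht : ∀ᶠ y in 𝓝 (chartAt R5 m m'), y ∈ (chartAt R5 m).target :=
    (chartAt R5 m).open_target.mem_nhds ((chartAt R5 m).map_source hm)
  filter_upwards [hc.eventually hφ, hc.eventually h1.eventually_nhds, ht] with y hy1 hy2 ht
  have hφy := hy1.mdifferentiableAt (by simp)
  have hsy := mdifferentiableAt_chartAt_symm ht
  have hφs : MDifferentiableAt 𝓘(ℝ, R5) 𝓘(ℝ, R5) (φ ∘ (chartAt R5 m).symm) y :=
    hφy.comp y hsy
  have hcφs : MDifferentiableAt 𝓘(ℝ, R5) 𝓘(ℝ, R5) (chartAt R5 n ∘ φ ∘ (chartAt R5 m).symm) y :=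
    (mdifferentiableAt_chartAt hy2.self_of_nhds).comp y hφs
  refine Eq.trans ?_ (congrFun (formPullback_eq_euclPullback _ (inChart β n)) y)
  unfold inChart
  rw [← formPullback_comp β hsy hφy, ← formPullback_comp β hcφs
    (mdifferentiableAt_chartAt_symm ((chartAt R5 n).map_source hy2.self_of_nhds))]
  refine formPullback_congr β ?_
  have hcont : Tendsto (chartAt R5 m).symm (𝓝 y) (𝓝 ((chartAt R5 m).symm y)) :=
    (chartAt R5 m).continuousAt_symm ht
  filter_upwards [hcont.eventually hy2] with z hz
  exact ((chartAt R5 n).left_inv hz).symm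

theorem contDiffAt_chart_comp {φ : M → N} {m m' : M} {n : N}
    (hm : m' ∈ (chartAt R5 m).source) (hn : φ m' ∈ (chartAt R5 n).source)
    (hφ : ContMDiffAt 𝓘(ℝ, R5) 𝓘(ℝ, R5) ∞ φ m') :
    ContDiffAt ℝ ∞ (chartAt R5 n ∘ φ ∘ (chartAt R5 m).symm) (chartAt R5 m m') := by
  rw [← contMDiffAt_iff_contDiffAt]
  have h1 : ContMDiffAt 𝓘(ℝ, R5) 𝓘(ℝ, R5) ∞ (chartAt R5 m).symm (chartAt R5 m m') :=
    contMDiffOn_chart_symm.contMDiffAt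
      ((chartAt R5 m).open_target.mem_nhds ((chartAt R5 m).map_source hm))
  have h2 : ContMDiffAt 𝓘(ℝ, R5) 𝓘(ℝ, R5) ∞ (chartAt R5 n) (φ m') :=
    contMDiffOn_chart.contMDiffAt ((chartAt R5 n).open_source.mem_nhds hn)
  have e := (chartAt R5 m).left_inv hm
  rw [← e] at hφ h2
  exact ContMDiffAt.comp (f := φ ∘ (chartAt R5 m).symm) _ h2 (hφ.comp _ h1)

theorem SmoothFormOn.pullback {k : ℕ} {φ : M → N} {β : Form N k} {U : Set M} {V : Set N}
    (hβ : SmoothFormOn β V) (hU : IsOpen U) (hφ : ContMDiffOn 𝓘(ℝ, R5) 𝓘(ℝ, R5) ∞ φ U)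
    (hUV : MapsTo φ U V) : SmoothFormOn (formPullback φ β) U := by
  intro m hm
  have h1 : ∀ᶠ z in 𝓝 m, ContMDiffAt 𝓘(ℝ, R5) 𝓘(ℝ, R5) ∞ φ z := by
    filter_upwards [hU.mem_nhds hm] with z hz using hφ.contMDiffAt (hU.mem_nhds hz)
  refine ContDiffAt.congr_of_eventuallyEq ?_ (inChart_formPullback_eventuallyEq β
    (mem_chart_source R5 m) (mem_chart_source R5 (φ m)) h1)
  refine contDiffAt_euclPullback (contDiffAt_chart_comp (mem_chart_source R5 m)
    (mem_chart_source R5 (φ m)) h1.self_of_nhds) ?_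
  have := hβ (φ m) (hUV hm)
  simpa using this

theorem inChart_eventuallyEq {k : ℕ} (β : Form M k) {m m' : M}
    (hm : m' ∈ (chartAt R5 m).source) :
    inChart β m =ᶠ[𝓝 (chartAt R5 m m')]
      euclPullback (chartAt R5 m' ∘ id ∘ (chartAt R5 m).symm) (inChart β m') := by
  have := inChart_formPullback_eventuallyEq (φ := (id : M → M)) β hm (mem_chart_source R5 m')
    (Eventually.of_forall fun z => contMDiffAt_id)
  rwa [formPullback_id] at this

/-- `SmoothFormOn` tests a form at `m'` only in the preferred chart at `m'`. The smooth transition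
map carries this over to every preferred chart around `m'`. -/
theorem SmoothFormOn.contDiffAt_inChart {k : ℕ} {β : Form M k} {U : Set M}
    (hβ : SmoothFormOn β U) {m m' : M} (hm : m' ∈ (chartAt R5 m).source) (hU : m' ∈ U) :
    ContDiffAt ℝ ∞ (inChart β m) (chartAt R5 m m') := by
  refine ContDiffAt.congr_of_eventuallyEq ?_ (inChart_eventuallyEq β hm)
  refine contDiffAt_euclPullback (contDiffAt_chart_comp hm (mem_chart_source R5 m')
    contMDiffAt_id) ?_
  simpa [(chartAt R5 m).left_inv hm] using hβ m' hU

/-- Independence of the exterior derivative of the chart: `extD` uses a different chart at each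
point, and `extDeriv` commutes with pullback along transition maps. -/
theorem SmoothFormOn.extDeriv_inChart {k : ℕ} {β : Form M k} {U : Set M}
    (hβ : SmoothFormOn β U) {m m' : M} (hm : m' ∈ (chartAt R5 m).source) (hU : m' ∈ U) :
    extDeriv (inChart β m) (chartAt R5 m m') = inChart (extD β) m (chartAt R5 m m') := by
  have hg := contDiffAt_chart_comp (φ := (id : M → M)) hm (mem_chart_source R5 m') contMDiffAt_id
  have hd : DifferentiableAt ℝ (inChart β m')
      ((chartAt R5 m' ∘ id ∘ (chartAt R5 m).symm) (chartAt R5 m m')) := by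
    have := (hβ m' hU).differentiableAt (by simp)
    simpa [(chartAt R5 m).left_inv hm] using this
  rw [(inChart_eventuallyEq β hm).extDeriv_eq]
  refine (extDeriv_pullback hd hg (by
    rw [minSmoothness_of_isRCLikeNormedField]; exact WithTop.coe_le_coe.2 le_top)).trans ?_
  have ht := (chartAt R5 m).map_source hm
  have hs := mdifferentiableAt_chartAt_symm ht
  have e := (chartAt R5 m).left_inv hm
  have h2 := formPullback_comp (extDeriv (inChart β m') : Form R5 (k + 1)) hs
    (mdifferentiableAt_chartAt (m := m') (by rw [e]; exact mem_chart_source R5 m'))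
  have h3 := congrFun (formPullback_eq_euclPullback (chartAt R5 m' ∘ (chartAt R5 m).symm)
    (extDeriv (inChart β m') : Form R5 (k + 1))) (chartAt R5 m m')
  refine (h3.symm.trans h2).trans ?_
  unfold inChart
  have h4 : ∀ p : M, p = m' →
      formPullback (chartAt R5 m') (extDeriv (inChart β m') : Form R5 (k + 1)) p = extD β p := by
    rintro _ rfl
    rfl
  have h5 := h4 _ e
  unfold formPullback at h5 ⊢
  exact congrArg (fun F : R5 [⋀^Fin (k + 1)]→L[ℝ] ℝ => F.compContinuousLinearMap
    (mfderiv 𝓘(ℝ, R5) 𝓘(ℝ, R5) (chartAt R5 m).symm (chartAt R5 m m') : R5 →L[ℝ] R5)) h5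

end PullbackForms

/-! ### Algebraic ideals of forms and the Leibniz rule. -/

section AlgIdealLemmas

open Set Filter Topology

variable {M : Type*} [TopologicalSpace M] [ChartedSpace R5 M]
variable {N : Type*} [TopologicalSpace N] [ChartedSpace R5 N]

theorem AlgIdeal.of_generators {S T : Set (Σ k, Form M k)} {U : Set M}
    (h : ∀ η ∈ T, AlgIdeal S U η.2) {k : ℕ} {β : Form M k} (hβ : AlgIdeal T U β) :
    AlgIdeal S U β := by
  induction hβ with
  | of β hβ => exact h _ hβ
  | zero k => exact .zero k
  | add β η _ _ h1 h2 => exact .add β η h1 h2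
  | wedge h α β hα _ h1 => exact .wedge h α β hα h1
  | congr β η _ h h1 => exact .congr β η h1 h

/-- Pullback respects sums and wedge products, so the generators alone need checking. -/
theorem AlgIdeal.pullback [IsManifold 𝓘(ℝ, R5) ∞ M] [IsManifold 𝓘(ℝ, R5) ∞ N] {φ : M → N}
    {S : Set (Σ k, Form M k)} {T : Set (Σ k, Form N k)} {U : Set M} {V : Set N}
    (hU : IsOpen U) (hφ : ContMDiffOn 𝓘(ℝ, R5) 𝓘(ℝ, R5) ∞ φ U) (hUV : MapsTo φ U V)
    (h : ∀ η ∈ T, AlgIdeal S U (formPullback φ η.2)) {k : ℕ} {β : Form N k}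
    (hβ : AlgIdeal T V β) : AlgIdeal S U (formPullback φ β) := by
  induction hβ with
  | of β hβ => exact h _ hβ
  | zero k => exact .zero k
  | add β η _ _ h1 h2 => exact .add _ _ h1 h2
  | wedge h α β hα _ h1 =>
    rw [formPullback_wedge]
    exact .wedge h _ _ (hα.pullback hU hφ hUV) h1
  | congr β η _ h h1 =>
    refine .congr _ _ h1 fun m hm => ?_
    unfold formPullback
    rw [h _ (hUV hm)]

/-- A function, viewed as a form of degree `0`. -/
noncomputable def functionForm (f : M → ℝ) : Form M 0 :=
  fun m => ContinuousAlternatingMap.constOfIsEmpty ℝ (TangentSpace 𝓘(ℝ, R5) m) (Fin 0) (f m)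

theorem AlgIdeal.smul {S : Set (Σ k, Form M k)} {U : Set M} {k : ℕ} {β : Form M k}
    (hβ : AlgIdeal S U β) {f : M → ℝ} (hf : SmoothFormOn (functionForm f) U) :
    AlgIdeal S U (fun m => f m • β m) := by
  refine (AlgIdeal.wedge (zero_add k) _ _ hf hβ).congr _ _ fun m _ => ?_
  exact altWedge_zero_left (V := R5) (zero_add k) _ _

theorem smoothFormOn_functionForm_const (c : ℝ) (U : Set M) :
    SmoothFormOn (functionForm fun _ : M => c) U := by
  intro m _
  have : inChart (functionForm fun _ : M => c) m = fun _ =>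
      ContinuousAlternatingMap.constOfIsEmpty ℝ R5 (Fin 0) c := by
    ext x v
    rfl
  rw [this]
  exact contDiffAt_const

theorem smoothFormOn_functionForm_self {f : R5 → ℝ} {U : Set R5}
    (hf : ∀ x ∈ U, ContDiffAt ℝ ∞ f x) : SmoothFormOn (functionForm f) U :=
  smoothFormOn_self.2 fun x hx => contDiffAt_continuousAlternatingMap_iff.2 fun _ => hf x hx

theorem AlgIdeal.const_smul {S : Set (Σ k, Form M k)} {U : Set M} {k : ℕ} {β : Form M k}
    (hβ : AlgIdeal S U β) (c : ℝ) : AlgIdeal S U (c • β) :=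
  hβ.smul (smoothFormOn_functionForm_const c U)

theorem AlgIdeal.neg {S : Set (Σ k, Form M k)} {U : Set M} {k : ℕ} {β : Form M k}
    (hβ : AlgIdeal S U β) : AlgIdeal S U (-β) := by
  exact (hβ.const_smul (-1)).congr _ _ fun m _ =>
    neg_one_smul ℝ (β m : R5 [⋀^Fin k]→L[ℝ] ℝ)

theorem AlgIdeal.sub {S : Set (Σ k, Form M k)} {U : Set M} {k : ℕ} {β η : Form M k}
    (hβ : AlgIdeal S U β) (hη : AlgIdeal S U η) : AlgIdeal S U (β - η) := by
  simpa [sub_eq_add_neg] using hβ.add _ _ hη.neg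

theorem SmoothFormOn.add {U : Set M} {k : ℕ} {β η : Form M k}
    (hβ : SmoothFormOn β U) (hη : SmoothFormOn η U) : SmoothFormOn (β + η) U :=
  fun m hm => (hβ m hm).add (hη m hm)

theorem SmoothFormOn.sub {U : Set M} {k : ℕ} {β η : Form M k}
    (hβ : SmoothFormOn β U) (hη : SmoothFormOn η U) : SmoothFormOn (β - η) U :=
  fun m hm => (hβ m hm).sub (hη m hm)

theorem SmoothFormOn.const_smul {U : Set M} {k : ℕ} {β : Form M k}
    (hβ : SmoothFormOn β U) (c : ℝ) : SmoothFormOn (c • β) U :=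
  fun m hm => (hβ m hm).const_smul c

theorem SmoothFormOn.mono {U V : Set M} {k : ℕ} {β : Form M k}
    (hβ : SmoothFormOn β V) (h : U ⊆ V) : SmoothFormOn β U :=
  fun m hm => hβ m (h hm)

theorem wedge₁_apply (α β : Form M 1) (m : M) (v : Fin 2 → TangentSpace 𝓘(ℝ, R5) m) :
    (α ⋏ β) m v = α m (fun _ => v 0) * β m (fun _ => v 1) -
      α m (fun _ => v 1) * β m (fun _ => v 0) :=
  altWedge_one_one (V := R5) _ _ _

theorem formWedge_one_two_apply (α : Form M 1) (β : Form M 2) (m : M)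
    (v : Fin 3 → TangentSpace 𝓘(ℝ, R5) m) :
    formWedge (rfl : 1 + 2 = 3) α β m v = α m (fun _ => v 0) * β m ![v 1, v 2] -
      α m (fun _ => v 1) * β m ![v 0, v 2] + α m (fun _ => v 2) * β m ![v 0, v 1] :=
  altWedge_one_two (V := R5) _ _ _

theorem extDeriv_one_apply {a : R5 → R5 [⋀^Fin 1]→L[ℝ] ℝ} {x : R5} (ha : DifferentiableAt ℝ a x)
    (v : Fin 2 → R5) :
    extDeriv a x v = fderiv ℝ (fun y => a y fun _ => v 1) x (v 0) -
      fderiv ℝ (fun y => a y fun _ => v 0) x (v 1) := by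
  rw [extDeriv_apply ha, Fin.sum_univ_two]
  have e0 : (0 : Fin 2).removeNth v = fun _ => v 1 := by ext i; fin_cases i; rfl
  have e1 : (1 : Fin 2).removeNth v = fun _ => v 0 := by ext i; fin_cases i; rfl
  rw [e0, e1]
  simp
  ring

theorem extDeriv_altWedge_one_one {a b : R5 → R5 [⋀^Fin 1]→L[ℝ] ℝ} {x : R5}
    (ha : ContDiffAt ℝ ∞ a x) (hb : ContDiffAt ℝ ∞ b x) (v : Fin 3 → R5) :
    extDeriv (fun y => altWedge (rfl : 1 + 1 = 2) (a y) (b y)) x v =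
      (extDeriv a x ![v 0, v 1] * b x (fun _ => v 2) - extDeriv a x ![v 0, v 2] * b x (fun _ => v 1)
        + extDeriv a x ![v 1, v 2] * b x (fun _ => v 0)) -
      (a x (fun _ => v 0) * extDeriv b x ![v 1, v 2] - a x (fun _ => v 1) * extDeriv b x ![v 0, v 2]
        + a x (fun _ => v 2) * extDeriv b x ![v 0, v 1]) := by
  have hc : ContDiffAt ℝ ∞ (fun y => altWedge (rfl : 1 + 1 = 2) (a y) (b y)) x := by
    refine contDiffAt_continuousAlternatingMap_iff.2 fun r => ?_
    simp only [altWedge_one_one]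
    exact ((ha.continuousAlternatingMap_apply fun _ => contDiffAt_const).mul
      (hb.continuousAlternatingMap_apply fun _ => contDiffAt_const)).sub
      ((ha.continuousAlternatingMap_apply fun _ => contDiffAt_const).mul
      (hb.continuousAlternatingMap_apply fun _ => contDiffAt_const))
  have hda : ∀ w : R5, DifferentiableAt ℝ (fun y => a y fun _ => w) x := fun w =>
    (ha.continuousAlternatingMap_apply fun _ => contDiffAt_const).differentiableAt (by simp)
  have hdb : ∀ w : R5, DifferentiableAt ℝ (fun y => b y fun _ => w) x := fun w =>
    (hb.continuousAlternatingMap_apply fun _ => contDiffAt_const).differentiableAt (by simp)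
  have hd : ∀ w : Fin 2 → R5, ∀ u,
      fderiv ℝ (fun y => altWedge (rfl : 1 + 1 = 2) (a y) (b y) w) x u =
      fderiv ℝ (fun y => a y fun _ => w 0) x u * b x (fun _ => w 1)
        + a x (fun _ => w 0) * fderiv ℝ (fun y => b y fun _ => w 1) x u
        - (fderiv ℝ (fun y => a y fun _ => w 1) x u * b x (fun _ => w 0)
        + a x (fun _ => w 1) * fderiv ℝ (fun y => b y fun _ => w 0) x u) := by
    intro w u
    simp only [altWedge_one_one]
    have := (((hda (w 0)).hasFDerivAt.fun_mul (hdb (w 1)).hasFDerivAt).fun_sub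
      ((hda (w 1)).hasFDerivAt.fun_mul (hdb (w 0)).hasFDerivAt)).fderiv
    rw [this]
    simp
    ring
  rw [extDeriv_apply (hc.differentiableAt (by simp))]
  refine (Fin.sum_univ_three _).trans ?_
  simp only [hd, extDeriv_one_apply (ha.differentiableAt (by simp)),
    extDeriv_one_apply (hb.differentiableAt (by simp))]
  have r0 : (0 : Fin 3).removeNth v = ![v 1, v 2] := by ext i; fin_cases i <;> rfl
  have r1 : (1 : Fin 3).removeNth v = ![v 0, v 2] := by ext i; fin_cases i <;> rfl
  have r2 : (2 : Fin 3).removeNth v = ![v 0, v 1] := by ext i; fin_cases i <;> rfl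
  simp [r0, r1, r2]
  ring

variable [IsManifold 𝓘(ℝ, R5) ∞ M]

theorem formPullback_chartAt_inChart {k : ℕ} (β : Form M k) {m m' : M}
    (hm : m' ∈ (chartAt R5 m).source) :
    formPullback (chartAt R5 m) (inChart β m : Form R5 k) m' = β m' := by
  unfold inChart
  rw [← formPullback_comp β (mdifferentiableAt_chartAt hm)
    (mdifferentiableAt_chartAt_symm ((chartAt R5 m).map_source hm))]
  have h : (chartAt R5 m).symm ∘ chartAt R5 m =ᶠ[𝓝 m'] id := by
    filter_upwards [(chartAt R5 m).open_source.mem_nhds hm] with z hz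
      using (chartAt R5 m).left_inv hz
  rw [formPullback_congr β h, formPullback_id]

/-- The rule `d(α∧β) = dα∧β - α∧dβ`, evaluated on three vectors. -/
theorem extD_wedge₁_apply {α β : Form M 1} {U : Set M} (hα : SmoothFormOn α U)
    (hβ : SmoothFormOn β U) {m : M} (hm : m ∈ U) (v : Fin 3 → TangentSpace 𝓘(ℝ, R5) m) :
    extD (α ⋏ β) m v =
      (extD α m ![v 0, v 1] * β m (fun _ => v 2) - extD α m ![v 0, v 2] * β m (fun _ => v 1)
        + extD α m ![v 1, v 2] * β m (fun _ => v 0)) -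
      (α m (fun _ => v 0) * extD β m ![v 1, v 2] - α m (fun _ => v 1) * extD β m ![v 0, v 2]
        + α m (fun _ => v 2) * extD β m ![v 0, v 1]) := by
  let D : R5 →L[ℝ] R5 := mfderiv 𝓘(ℝ, R5) 𝓘(ℝ, R5) (chartAt R5 m) m
  have h1 : inChart (α ⋏ β) m =
      fun y => altWedge (rfl : 1 + 1 = 2) (inChart α m y) (inChart β m y) :=
    formPullback_wedge (rfl : 1 + 1 = 2) (chartAt R5 m).symm α β
  have h2 := extDeriv_altWedge_one_one (hα m hm) (hβ m hm) (fun i => D (v i))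
  rw [← h1] at h2
  have e : ∀ (γ : Form M 1) (w : TangentSpace 𝓘(ℝ, R5) m), γ m (fun _ => w) =
      inChart γ m (chartAt R5 m m) (fun _ => D w) := by
    intro γ w
    conv_lhs => rw [← formPullback_chartAt_inChart γ (mem_chart_source R5 m)]
    rfl
  have e2 : ∀ (γ : Form M 1) (w w' : TangentSpace 𝓘(ℝ, R5) m), extD γ m ![w, w'] =
      extDeriv (inChart γ m) (chartAt R5 m m) ![D w, D w'] := by
    intro γ w w'
    have : (fun i => D ((![w, w'] : Fin 2 → R5) i)) = ![D w, D w'] := by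
      ext i; fin_cases i <;> rfl
    rw [← this]
    rfl
  simp only [e, e2]
  exact h2

end AlgIdealLemmas

/-! ### The structure equations and the ideal of a coframing. -/

section StructureEquations

open Set Filter Topology

variable {M : Type*} [TopologicalSpace M] [ChartedSpace R5 M]

/-- The values of a 1-form on single vectors. -/
noncomputable def covec (α : Form M 1) (m : M) (v : R5) : ℝ := α m fun _ => v

theorem covec_add (α β : Form M 1) (m : M) (v : R5) :
    covec (α + β) m v = covec α m v + covec β m v := rfl

theorem covec_sub (α β : Form M 1) (m : M) (v : R5) :
    covec (α - β) m v = covec α m v - covec β m v := rfl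

theorem covec_smul (c : ℝ) (α : Form M 1) (m : M) (v : R5) :
    covec (c • α) m v = c * covec α m v := rfl

theorem wedge₁_apply_covec (α β : Form M 1) (m : M) (v : Fin 2 → R5) :
    ((α ⋏ β) m : R5 [⋀^Fin 2]→L[ℝ] ℝ) v =
      covec α m (v 0) * covec β m (v 1) - covec α m (v 1) * covec β m (v 0) :=
  wedge₁_apply α β m v

theorem wedge₁_apply_pair (α β : Form M 1) (m : M) (v w : R5) :
    ((α ⋏ β) m : R5 [⋀^Fin 2]→L[ℝ] ℝ) ![v, w] =
      covec α m v * covec β m w - covec α m w * covec β m v :=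
  wedge₁_apply α β m ![v, w]

theorem twoForm_ext_iff {α β : R5 [⋀^Fin 2]→L[ℝ] ℝ} :
    α = β ↔ ∀ v w, α ![v, w] = β ![v, w] := by
  refine ⟨fun h v w => by rw [h], fun h => ?_⟩
  ext v
  have hv : v = ![v 0, v 1] := by ext i; fin_cases i <;> rfl
  rw [hv]
  exact h _ _

/-- Evaluated on pairs of vectors, the equations become polynomial identities between real numbers,
open to `ring`. -/
theorem structureEquationsOn_iff {ε : ℝ} {σ : Fin 5 → Form M 1} {U : Set M} :
    StructureEquationsOn ε σ U ↔ ∀ m ∈ U, ∀ v w : R5,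
    (extD (σ 0) m : R5 [⋀^Fin 2]→L[ℝ] ℝ) ![v, w] =
      -ε * (covec (σ 0) m v * (covec (σ 2) m w - covec (σ 4) m w) -
        covec (σ 0) m w * (covec (σ 2) m v - covec (σ 4) m v)) +
      (covec (σ 1) m v * covec (σ 2) m w - covec (σ 1) m w * covec (σ 2) m v) +
      (covec (σ 3) m v * covec (σ 4) m w - covec (σ 3) m w * covec (σ 4) m v) ∧
    (extD (σ 1) m : R5 [⋀^Fin 2]→L[ℝ] ℝ) ![v, w] =
      ε * (covec (σ 1) m v * (covec (σ 2) m w + covec (σ 3) m w + covec (σ 4) m w) -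
        covec (σ 1) m w * (covec (σ 2) m v + covec (σ 3) m v + covec (σ 4) m v)) ∧
    (extD (σ 2) m : R5 [⋀^Fin 2]→L[ℝ] ℝ) ![v, w] =
      (covec (σ 0) m v * (covec (σ 2) m w - covec (σ 4) m w) -
        covec (σ 0) m w * (covec (σ 2) m v - covec (σ 4) m v)) -
      ε * ((covec (σ 1) m v - covec (σ 3) m v) * covec (σ 2) m w -
        (covec (σ 1) m w - covec (σ 3) m w) * covec (σ 2) m v) ∧
    (extD (σ 3) m : R5 [⋀^Fin 2]→L[ℝ] ℝ) ![v, w] =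
      -ε * (covec (σ 3) m v * (covec (σ 1) m w + covec (σ 2) m w + covec (σ 4) m w) -
        covec (σ 3) m w * (covec (σ 1) m v + covec (σ 2) m v + covec (σ 4) m v)) ∧
    (extD (σ 4) m : R5 [⋀^Fin 2]→L[ℝ] ℝ) ![v, w] =
      -(covec (σ 0) m v * (covec (σ 2) m w - covec (σ 4) m w) -
        covec (σ 0) m w * (covec (σ 2) m v - covec (σ 4) m v)) -
      ε * ((covec (σ 1) m v - covec (σ 3) m v) * covec (σ 4) m w -
        (covec (σ 1) m w - covec (σ 3) m w) * covec (σ 4) m v) := by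
  refine forall₂_congr fun m _ => ?_
  simp only [forall_and]
  refine and_congr (twoForm_ext_iff.trans ?_) (and_congr (twoForm_ext_iff.trans ?_)
    (and_congr (twoForm_ext_iff.trans ?_) (and_congr (twoForm_ext_iff.trans ?_)
    (twoForm_ext_iff.trans ?_)))) <;>
  refine forall₂_congr fun v w => Eq.congr_right ?_
  · change -ε * ((σ 0 ⋏ (σ 2 - σ 4)) m : R5 [⋀^Fin 2]→L[ℝ] ℝ) ![v, w] +
      ((σ 1 ⋏ σ 2) m : R5 [⋀^Fin 2]→L[ℝ] ℝ) ![v, w] +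
      ((σ 3 ⋏ σ 4) m : R5 [⋀^Fin 2]→L[ℝ] ℝ) ![v, w] = _
    simp only [wedge₁_apply_pair, covec_sub]
  · change ε * ((σ 1 ⋏ (σ 2 + σ 3 + σ 4)) m : R5 [⋀^Fin 2]→L[ℝ] ℝ) ![v, w] = _
    simp only [wedge₁_apply_pair, covec_add]
  · change ((σ 0 ⋏ (σ 2 - σ 4)) m : R5 [⋀^Fin 2]→L[ℝ] ℝ) ![v, w] -
      ε * (((σ 1 - σ 3) ⋏ σ 2) m : R5 [⋀^Fin 2]→L[ℝ] ℝ) ![v, w] = _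
    simp only [wedge₁_apply_pair, covec_sub]
  · change -ε * ((σ 3 ⋏ (σ 1 + σ 2 + σ 4)) m : R5 [⋀^Fin 2]→L[ℝ] ℝ) ![v, w] = _
    simp only [wedge₁_apply_pair, covec_add]
  · change -((σ 0 ⋏ (σ 2 - σ 4)) m : R5 [⋀^Fin 2]→L[ℝ] ℝ) ![v, w] -
      ε * (((σ 1 - σ 3) ⋏ σ 4) m : R5 [⋀^Fin 2]→L[ℝ] ℝ) ![v, w] = _
    simp only [wedge₁_apply_pair, covec_sub]

/-- The 1-form and the two decomposable 2-forms that generate the ideal of a coframing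
algebraically. -/
noncomputable def coframeAlgGenerators (σ : Fin 5 → Form M 1) : Set (Σ k, Form M k) :=
  {⟨1, σ 0⟩, ⟨2, σ 1 ⋏ σ 2⟩, ⟨2, σ 3 ⋏ σ 4⟩}

variable [IsManifold 𝓘(ℝ, R5) ∞ M]

/-- By (1) the exterior derivatives of the three generators already lie in the algebraic ideal of
the generators, so that ideal is differentially closed. -/
theorem algIdeal_coframeAlgGenerators_of_mem {ε : ℝ} {σ : Fin 5 → Form M 1} {U : Set M}
    (hσ : ∀ i, SmoothFormOn (σ i) U) (hs : StructureEquationsOn ε σ U) :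
    ∀ η ∈ coframeGenerators σ, AlgIdeal (coframeAlgGenerators σ) U η.2 := by
  have h0 : AlgIdeal (coframeAlgGenerators σ) U (σ 0) := .of _ (by simp [coframeAlgGenerators])
  have h12 : AlgIdeal (coframeAlgGenerators σ) U (σ 1 ⋏ σ 2) :=
    .of _ (by simp [coframeAlgGenerators])
  have h34 : AlgIdeal (coframeAlgGenerators σ) U (σ 3 ⋏ σ 4) :=
    .of _ (by simp [coframeAlgGenerators])
  have hw : ∀ (α : Form M 1) (β : Form M 1), SmoothFormOn α U →
      AlgIdeal (coframeAlgGenerators σ) U β → AlgIdeal (coframeAlgGenerators σ) U (α ⋏ β) :=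
    fun α β hα hβ => .wedge rfl α β hα hβ
  rintro η (hη | ⟨β, hβ, rfl⟩)
  · rcases hη with rfl | rfl | rfl
    exacts [h0, h12, h34]
  · rcases hβ with rfl | rfl | rfl
    · refine .congr (ε • (((σ 2 - σ 4)) ⋏ σ 0) + σ 1 ⋏ σ 2 + σ 3 ⋏ σ 4) _
        (((((hw _ _ ((hσ 2).sub (hσ 4)) h0).const_smul ε).add _ _ h12).add _ _ h34)) fun m hm => ?_
      refine Eq.trans ?_ (hs m hm).1.symm
      refine ContinuousAlternatingMap.ext fun (v : Fin 2 → R5) => ?_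
      change ε * (((σ 2 - σ 4) ⋏ σ 0) m : R5 [⋀^Fin 2]→L[ℝ] ℝ) v +
        ((σ 1 ⋏ σ 2) m : R5 [⋀^Fin 2]→L[ℝ] ℝ) v + ((σ 3 ⋏ σ 4) m : R5 [⋀^Fin 2]→L[ℝ] ℝ) v =
        -ε * ((σ 0 ⋏ (σ 2 - σ 4)) m : R5 [⋀^Fin 2]→L[ℝ] ℝ) v +
        ((σ 1 ⋏ σ 2) m : R5 [⋀^Fin 2]→L[ℝ] ℝ) v + ((σ 3 ⋏ σ 4) m : R5 [⋀^Fin 2]→L[ℝ] ℝ) v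
      simp only [wedge₁_apply_covec, covec_sub]
      ring
    -- From (1), `d(σ¹∧σ²) = (σ⁰ - ε σ⁴)∧σ¹∧σ² - σ¹∧σ⁴∧σ⁰`: the terms with `σ³` cancel.
    · refine .congr (formWedge (rfl : 1 + 2 = 3) (σ 0 - ε • σ 4) (σ 1 ⋏ σ 2) -
          formWedge (rfl : 1 + 2 = 3) (σ 1) (σ 4 ⋏ σ 0)) _
        ((AlgIdeal.wedge _ _ _ ((hσ 0).sub ((hσ 4).const_smul ε)) h12).sub
          (AlgIdeal.wedge _ _ _ (hσ 1) (hw _ _ (hσ 4) h0))) fun m hm => ?_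
      refine ContinuousAlternatingMap.ext fun (v : Fin 3 → R5) => ?_
      refine Eq.trans ?_ (extD_wedge₁_apply (hσ 1) (hσ 2) hm v).symm
      refine (congrArg₂ (· - ·) (formWedge_one_two_apply _ _ m v)
        (formWedge_one_two_apply _ _ m v)).trans ?_
      have e := structureEquationsOn_iff.1 hs m hm
      change (covec (σ 0 - ε • σ 4) m (v 0) *
          ((σ 1 ⋏ σ 2) m : R5 [⋀^Fin 2]→L[ℝ] ℝ) ![v 1, v 2] - covec (σ 0 - ε • σ 4) m (v 1) *
          ((σ 1 ⋏ σ 2) m : R5 [⋀^Fin 2]→L[ℝ] ℝ) ![v 0, v 2] + covec (σ 0 - ε • σ 4) m (v 2) *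
          ((σ 1 ⋏ σ 2) m : R5 [⋀^Fin 2]→L[ℝ] ℝ) ![v 0, v 1]) - (covec (σ 1) m (v 0) *
          ((σ 4 ⋏ σ 0) m : R5 [⋀^Fin 2]→L[ℝ] ℝ) ![v 1, v 2] - covec (σ 1) m (v 1) *
          ((σ 4 ⋏ σ 0) m : R5 [⋀^Fin 2]→L[ℝ] ℝ) ![v 0, v 2] + covec (σ 1) m (v 2) *
          ((σ 4 ⋏ σ 0) m : R5 [⋀^Fin 2]→L[ℝ] ℝ) ![v 0, v 1]) =
        ((extD (σ 1) m : R5 [⋀^Fin 2]→L[ℝ] ℝ) ![v 0, v 1] * covec (σ 2) m (v 2) -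
          (extD (σ 1) m : R5 [⋀^Fin 2]→L[ℝ] ℝ) ![v 0, v 2] * covec (σ 2) m (v 1) +
          (extD (σ 1) m : R5 [⋀^Fin 2]→L[ℝ] ℝ) ![v 1, v 2] * covec (σ 2) m (v 0)) -
        (covec (σ 1) m (v 0) * (extD (σ 2) m : R5 [⋀^Fin 2]→L[ℝ] ℝ) ![v 1, v 2] -
          covec (σ 1) m (v 1) * (extD (σ 2) m : R5 [⋀^Fin 2]→L[ℝ] ℝ) ![v 0, v 2] +
          covec (σ 1) m (v 2) * (extD (σ 2) m : R5 [⋀^Fin 2]→L[ℝ] ℝ) ![v 0, v 1])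
      simp only [wedge₁_apply_pair, covec_sub, covec_smul, (e _ _).2.1, (e _ _).2.2.1]
      ring
    -- Likewise `d(σ³∧σ⁴) = (σ⁰ + ε σ²)∧σ³∧σ⁴ - σ³∧σ²∧σ⁰`.
    · refine .congr (formWedge (rfl : 1 + 2 = 3) (σ 0 + ε • σ 2) (σ 3 ⋏ σ 4) -
          formWedge (rfl : 1 + 2 = 3) (σ 3) (σ 2 ⋏ σ 0)) _
        ((AlgIdeal.wedge _ _ _ ((hσ 0).add ((hσ 2).const_smul ε)) h34).sub
          (AlgIdeal.wedge _ _ _ (hσ 3) (hw _ _ (hσ 2) h0))) fun m hm => ?_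
      refine ContinuousAlternatingMap.ext fun (v : Fin 3 → R5) => ?_
      refine Eq.trans ?_ (extD_wedge₁_apply (hσ 3) (hσ 4) hm v).symm
      refine (congrArg₂ (· - ·) (formWedge_one_two_apply _ _ m v)
        (formWedge_one_two_apply _ _ m v)).trans ?_
      have e := structureEquationsOn_iff.1 hs m hm
      change (covec (σ 0 + ε • σ 2) m (v 0) *
          ((σ 3 ⋏ σ 4) m : R5 [⋀^Fin 2]→L[ℝ] ℝ) ![v 1, v 2] - covec (σ 0 + ε • σ 2) m (v 1) *
          ((σ 3 ⋏ σ 4) m : R5 [⋀^Fin 2]→L[ℝ] ℝ) ![v 0, v 2] + covec (σ 0 + ε • σ 2) m (v 2) *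
          ((σ 3 ⋏ σ 4) m : R5 [⋀^Fin 2]→L[ℝ] ℝ) ![v 0, v 1]) - (covec (σ 3) m (v 0) *
          ((σ 2 ⋏ σ 0) m : R5 [⋀^Fin 2]→L[ℝ] ℝ) ![v 1, v 2] - covec (σ 3) m (v 1) *
          ((σ 2 ⋏ σ 0) m : R5 [⋀^Fin 2]→L[ℝ] ℝ) ![v 0, v 2] + covec (σ 3) m (v 2) *
          ((σ 2 ⋏ σ 0) m : R5 [⋀^Fin 2]→L[ℝ] ℝ) ![v 0, v 1]) =
        ((extD (σ 3) m : R5 [⋀^Fin 2]→L[ℝ] ℝ) ![v 0, v 1] * covec (σ 4) m (v 2) -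
          (extD (σ 3) m : R5 [⋀^Fin 2]→L[ℝ] ℝ) ![v 0, v 2] * covec (σ 4) m (v 1) +
          (extD (σ 3) m : R5 [⋀^Fin 2]→L[ℝ] ℝ) ![v 1, v 2] * covec (σ 4) m (v 0)) -
        (covec (σ 3) m (v 0) * (extD (σ 4) m : R5 [⋀^Fin 2]→L[ℝ] ℝ) ![v 1, v 2] -
          covec (σ 3) m (v 1) * (extD (σ 4) m : R5 [⋀^Fin 2]→L[ℝ] ℝ) ![v 0, v 2] +
          covec (σ 3) m (v 2) * (extD (σ 4) m : R5 [⋀^Fin 2]→L[ℝ] ℝ) ![v 0, v 1])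
      simp only [wedge₁_apply_pair, covec_add, covec_smul, (e _ _).2.2.2.1,
        (e _ _).2.2.2.2]
      ring

theorem algIdeal_coframeGenerators_iff {ε : ℝ} {σ : Fin 5 → Form M 1} {U : Set M}
    (hσ : ∀ i, SmoothFormOn (σ i) U) (hs : StructureEquationsOn ε σ U) {k : ℕ} {β : Form M k} :
    AlgIdeal (coframeGenerators σ) U β ↔ AlgIdeal (coframeAlgGenerators σ) U β :=
  ⟨fun h => h.of_generators (algIdeal_coframeAlgGenerators_of_mem hσ hs),
    fun h => h.of_generators fun η hη => .of η.2 (Or.inl hη)⟩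

end StructureEquations

/-! ### The explicit coframing of the Goursat equation and its exterior derivatives. -/

section GoursatCoframe

open Set Filter Topology

/-- The coordinate covectors of `ℝ⁵` as alternating forms. -/
noncomputable def coordAlt (j : Fin 5) : R5 [⋀^Fin 1]→L[ℝ] ℝ :=
  ContinuousAlternatingMap.ofSubsingleton ℝ R5 ℝ (0 : Fin 1) (EuclideanSpace.proj j)

/-- The coefficient form `∑ j, c j dx_j`, as a map into alternating forms on `ℝ⁵`. -/
noncomputable def oneFormMap (c : Fin 5 → R5 → ℝ) : R5 → R5 [⋀^Fin 1]→L[ℝ] ℝ :=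
  fun u => ∑ j, c j u • coordAlt j

/-- The 1-form `∑ j, c j dx_j` on `ℝ⁵`. -/
noncomputable def oneForm (c : Fin 5 → R5 → ℝ) : Form R5 1 := oneFormMap c

theorem covec_oneForm (c : Fin 5 → R5 → ℝ) (u v : R5) :
    covec (oneForm c) u v = ∑ j, c j u * v j := by
  change (∑ j, c j u • coordAlt j) (fun _ => v) = _
  rw [ContinuousAlternatingMap.sum_apply]
  rfl

theorem contDiffAt_oneFormMap {c : Fin 5 → R5 → ℝ} {x : R5}
    (hc : ∀ j, ContDiffAt ℝ ∞ (c j) x) : ContDiffAt ℝ ∞ (oneFormMap c) x :=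
  ContDiffAt.sum fun j _ => (hc j).smul contDiffAt_const

theorem smoothFormOn_oneForm {c : Fin 5 → R5 → ℝ} {U : Set R5}
    (hc : ∀ j, ∀ x ∈ U, ContDiffAt ℝ ∞ (c j) x) : SmoothFormOn (oneForm c) U :=
  smoothFormOn_self.2 fun x hx => contDiffAt_oneFormMap fun j => hc j x hx

theorem extD_oneForm_apply {c : Fin 5 → R5 → ℝ} {u : R5} {c' : Fin 5 → R5 →L[ℝ] ℝ}
    (hc : ∀ j, HasFDerivAt (c j) (c' j) u) (v w : R5) :
    (extD (oneForm c) u : R5 [⋀^Fin 2]→L[ℝ] ℝ) ![v, w] =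
      ∑ j, (c' j v * w j - c' j w * v j) := by
  have hd : DifferentiableAt ℝ (oneFormMap c) u :=
    DifferentiableAt.fun_sum fun j _ => (hc j).differentiableAt.smul_const _
  have h1 : ∀ w : R5, HasFDerivAt (fun y => covec (oneForm c) y w) (∑ j, w j • c' j) u := by
    intro w
    simp only [covec_oneForm]
    exact HasFDerivAt.fun_sum fun j _ => by
      simpa using (hc j).mul_const (w j)
  rw [extD_self]
  refine (extDeriv_one_apply hd ![v, w]).trans ?_
  change fderiv ℝ (fun y => covec (oneForm c) y w) u v -
    fderiv ℝ (fun y => covec (oneForm c) y v) u w = _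
  rw [(h1 w).fderiv, (h1 v).fderiv, Finset.sum_sub_distrib]
  simp [mul_comm]

/-- The relative invariant `1 / ((x + y) √(p q))` of the Goursat equation. -/
noncomputable def goursatDensity (u : R5) : ℝ := ((u 0 + u 1) * √(u 3 * u 4))⁻¹

/-- Coefficients of the coframing of the Goursat equation. -/
noncomputable def goursatCoeff (ε : ℝ) : Fin 5 → Fin 5 → R5 → ℝ :=
  ![![fun u => -(1 / 2) * (u 3 * goursatDensity u), fun u => -(1 / 2) * (u 4 * goursatDensity u),
      fun u => 1 / 2 * goursatDensity u, fun _ => 0, fun _ => 0],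
    ![fun u => -ε * (u 3 * goursatDensity u), fun _ => 0, fun _ => 0, fun _ => 0, fun _ => 0],
    ![fun u => -ε / 2 * (2 * (u 0 + u 1)⁻¹ - u 3 * goursatDensity u),
      fun u => -ε / 2 * (u 4 * goursatDensity u), fun u => -ε / 2 * goursatDensity u,
      fun u => -ε / 2 * (u 3)⁻¹, fun _ => 0],
    ![fun _ => 0, fun u => ε * (u 4 * goursatDensity u), fun _ => 0, fun _ => 0, fun _ => 0],
    ![fun u => ε / 2 * (u 3 * goursatDensity u),
      fun u => ε / 2 * (2 * (u 0 + u 1)⁻¹ - u 4 * goursatDensity u),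
      fun u => ε / 2 * goursatDensity u, fun _ => 0, fun u => ε / 2 * (u 4)⁻¹]]

/-- The coframing of the Goursat equation. -/
noncomputable def goursatCoframe (ε : ℝ) (i : Fin 5) : Form R5 1 := oneForm (goursatCoeff ε i)

theorem isOpen_goursatDomain : IsOpen goursatDomain := by
  have hc : ∀ j : Fin 5, Continuous fun u : R5 => u j := fun j =>
    (EuclideanSpace.proj j : R5 →L[ℝ] ℝ).continuous
  exact (isOpen_ne_fun ((hc 0).add (hc 1)) continuous_const).inter
    (isOpen_lt continuous_const ((hc 3).mul (hc 4)))

theorem hasFDerivAt_coord (j : Fin 5) (u : R5) :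
    HasFDerivAt (fun u : R5 => u j) (EuclideanSpace.proj j : R5 →L[ℝ] ℝ) u :=
  (EuclideanSpace.proj j : R5 →L[ℝ] ℝ).hasFDerivAt

theorem contDiffAt_coord (j : Fin 5) (u : R5) : ContDiffAt ℝ ∞ (fun u : R5 => u j) u :=
  (EuclideanSpace.proj j : R5 →L[ℝ] ℝ).contDiff.contDiffAt

theorem contDiffAt_goursatDensity {u : R5} (hu : u ∈ goursatDomain) :
    ContDiffAt ℝ ∞ goursatDensity u := by
  refine ContDiffAt.inv (((contDiffAt_coord 0 u).add (contDiffAt_coord 1 u)).mul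
    (((contDiffAt_coord 3 u).mul (contDiffAt_coord 4 u)).sqrt hu.2.ne')) ?_
  exact mul_ne_zero hu.1 (Real.sqrt_pos.2 hu.2).ne'

theorem ne_zero_of_mem_goursatDomain {u : R5} (hu : u ∈ goursatDomain) : u 3 ≠ 0 ∧ u 4 ≠ 0 :=
  ⟨left_ne_zero_of_mul hu.2.ne', right_ne_zero_of_mul hu.2.ne'⟩

theorem contDiffAt_goursatCoeff (ε : ℝ) (i j : Fin 5) {u : R5} (hu : u ∈ goursatDomain) :
    ContDiffAt ℝ ∞ (goursatCoeff ε i j) u := by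
  have hk := contDiffAt_goursatDensity hu
  have h3 := contDiffAt_coord 3 u
  have h4 := contDiffAt_coord 4 u
  have hD := ((contDiffAt_coord 0 u).add (contDiffAt_coord 1 u)).inv hu.1
  have h3i := h3.inv (ne_zero_of_mem_goursatDomain hu).1
  have h4i := h4.inv (ne_zero_of_mem_goursatDomain hu).2
  have c : ∀ a : ℝ, ContDiffAt ℝ ∞ (fun _ : R5 => a) u := fun _ => contDiffAt_const
  fin_cases i <;> fin_cases j
  exacts [(c _).mul (h3.mul hk), (c _).mul (h4.mul hk), (c _).mul hk, c _, c _,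
    (c _).mul (h3.mul hk), c _, c _, c _, c _,
    (c _).mul (((c 2).mul hD).sub (h3.mul hk)), (c _).mul (h4.mul hk), (c _).mul hk,
    (c _).mul h3i, c _,
    c _, (c _).mul (h4.mul hk), c _, c _, c _,
    (c _).mul (h3.mul hk), (c _).mul (((c 2).mul hD).sub (h4.mul hk)), (c _).mul hk, c _,
    (c _).mul h4i]

theorem smoothFormOn_goursatCoframe (ε : ℝ) (i : Fin 5) :
    SmoothFormOn (goursatCoframe ε i) goursatDomain :=
  smoothFormOn_oneForm fun j _ hx => contDiffAt_goursatCoeff ε i j hx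

/-- Logarithmic differentiation of `k = 1/((x+y)√(pq))`: `dk/k = -(dx+dy)/(x+y) - dp/(2p) -
dq/(2q)`. -/
theorem hasFDerivAt_goursatDensity {u : R5} (hu : u ∈ goursatDomain) :
    HasFDerivAt goursatDensity
      (-goursatDensity u •
        ((u 0 + u 1)⁻¹ • ((EuclideanSpace.proj 0 : R5 →L[ℝ] ℝ) + EuclideanSpace.proj 1) +
          (2 * u 3)⁻¹ • (EuclideanSpace.proj 3 : R5 →L[ℝ] ℝ) +
          (2 * u 4)⁻¹ • (EuclideanSpace.proj 4 : R5 →L[ℝ] ℝ))) u := by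
  have hs := (Real.sqrt_pos.2 hu.2).ne'
  have hD := hu.1
  obtain ⟨h3, h4⟩ := ne_zero_of_mem_goursatDomain hu
  have hsq : √(u 3 * u 4) ^ 2 = u 3 * u 4 := Real.sq_sqrt hu.2.le
  have := (hasDerivAt_inv (mul_ne_zero hD hs)).comp_hasFDerivAt u
    (((hasFDerivAt_coord 0 u).fun_add (hasFDerivAt_coord 1 u)).fun_mul
    (((hasFDerivAt_coord 3 u).fun_mul (hasFDerivAt_coord 4 u)).sqrt hu.2.ne'))
  refine this.congr_fderiv ?_
  ext v
  simp [goursatDensity]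
  generalize √(u 3 * u 4) = s at *
  field_simp
  linear_combination ((u 0 + u 1) * (v 3 * u 4 + u 3 * v 4)) * hsq

/-- The coframing is adapted to the two characteristic systems. With `k` the density one has `F =
-2pqk`, so modulo `θ` and `dx` the third form is `-ε/(2p) (dp - F dy)`, and modulo `θ` and `dy` the
fifth is `ε/(2q) (dq - F dx)`. -/
theorem covec_goursatCoframe (ε : ℝ) (u v : R5) :
    covec (goursatCoframe ε 0) u v =
      goursatDensity u / 2 * (v 2 - u 3 * v 0 - u 4 * v 1) ∧
    covec (goursatCoframe ε 1) u v = -ε * u 3 * goursatDensity u * v 0 ∧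
    covec (goursatCoframe ε 2) u v = -ε / 2 * ((u 3)⁻¹ * v 3 + 2 * (u 0 + u 1)⁻¹ * v 0 +
      goursatDensity u * (v 2 - u 3 * v 0 + u 4 * v 1)) ∧
    covec (goursatCoframe ε 3) u v = ε * u 4 * goursatDensity u * v 1 ∧
    covec (goursatCoframe ε 4) u v = ε / 2 * ((u 4)⁻¹ * v 4 + 2 * (u 0 + u 1)⁻¹ * v 1 +
      goursatDensity u * (v 2 + u 3 * v 0 - u 4 * v 1)) := by
  refine ⟨?_, ?_, ?_, ?_, ?_⟩ <;>
    simp [goursatCoframe, covec_oneForm, goursatCoeff, Fin.sum_univ_five,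
      -mul_eq_mul_right_iff, -mul_eq_mul_left_iff] <;> ring

/-- The local functions `dk`, `dD`, `dpk`, `dqk` are the differentials of `k`, `1/(x+y)`, `pk`,
`qk`. The closed terms `dp/p` and `dq/q` contribute nothing. -/
theorem extD_goursatCoframe_apply (ε : ℝ) {u : R5} (hu : u ∈ goursatDomain) (v w : R5) :
    let k := goursatDensity u
    let dk : R5 → ℝ := fun v => -k * ((u 0 + u 1)⁻¹ * (v 0 + v 1) + (2 * u 3)⁻¹ * v 3
      + (2 * u 4)⁻¹ * v 4)
    let dD : R5 → ℝ := fun v => -((u 0 + u 1) ^ 2)⁻¹ * (v 0 + v 1)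
    let dpk : R5 → ℝ := fun v => u 3 * dk v + k * v 3
    let dqk : R5 → ℝ := fun v => u 4 * dk v + k * v 4
    (extD (goursatCoframe ε 0) u : R5 [⋀^Fin 2]→L[ℝ] ℝ) ![v, w] =
      1 / 2 * (dk v * w 2 - dk w * v 2 - (dpk v * w 0 - dpk w * v 0) -
        (dqk v * w 1 - dqk w * v 1)) ∧
    (extD (goursatCoframe ε 1) u : R5 [⋀^Fin 2]→L[ℝ] ℝ) ![v, w] =
      -ε * (dpk v * w 0 - dpk w * v 0) ∧
    (extD (goursatCoframe ε 2) u : R5 [⋀^Fin 2]→L[ℝ] ℝ) ![v, w] =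
      -ε / 2 * (2 * (dD v * w 0 - dD w * v 0) - (dpk v * w 0 - dpk w * v 0)
        + (dqk v * w 1 - dqk w * v 1) + (dk v * w 2 - dk w * v 2)) ∧
    (extD (goursatCoframe ε 3) u : R5 [⋀^Fin 2]→L[ℝ] ℝ) ![v, w] =
      ε * (dqk v * w 1 - dqk w * v 1) ∧
    (extD (goursatCoframe ε 4) u : R5 [⋀^Fin 2]→L[ℝ] ℝ) ![v, w] =
      ε / 2 * (2 * (dD v * w 1 - dD w * v 1) + (dpk v * w 0 - dpk w * v 0)
        - (dqk v * w 1 - dqk w * v 1) + (dk v * w 2 - dk w * v 2)) := by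
  obtain ⟨h3, h4⟩ := ne_zero_of_mem_goursatDomain hu
  have hk := hasFDerivAt_goursatDensity hu
  have hpk := (hasFDerivAt_coord 3 u).fun_mul hk
  have hqk := (hasFDerivAt_coord 4 u).fun_mul hk
  have hD := (hasDerivAt_inv hu.1).comp_hasFDerivAt u
    ((hasFDerivAt_coord 0 u).fun_add (hasFDerivAt_coord 1 u))
  have hp := (hasDerivAt_inv h3).comp_hasFDerivAt u (hasFDerivAt_coord 3 u)
  have hq := (hasDerivAt_inv h4).comp_hasFDerivAt u (hasFDerivAt_coord 4 u)
  have c : ∀ a : ℝ, HasFDerivAt (fun _ : R5 => a) (0 : R5 →L[ℝ] ℝ) u :=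
    fun _ => hasFDerivAt_const _ _
  intro k dk dD dpk dqk
  refine ⟨?_, ?_, ?_, ?_, ?_⟩
  · refine (extD_oneForm_apply (c' := ![_, _, _, 0, 0]) (Fin.forall_fin_succ.2
      ⟨hpk.const_mul _, Fin.forall_fin_succ.2 ⟨hqk.const_mul _, Fin.forall_fin_succ.2
      ⟨hk.const_mul _, Fin.forall_fin_succ.2 ⟨c _, Fin.forall_fin_one.2 (c _)⟩⟩⟩⟩) v w).trans ?_
    simp [Fin.sum_univ_five, dk, dpk, dqk, k]
    ring
  · refine (extD_oneForm_apply (c' := ![_, 0, 0, 0, 0]) (Fin.forall_fin_succ.2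
      ⟨hpk.const_mul _, Fin.forall_fin_succ.2 ⟨c _, Fin.forall_fin_succ.2
      ⟨c _, Fin.forall_fin_succ.2 ⟨c _, Fin.forall_fin_one.2 (c _)⟩⟩⟩⟩) v w).trans ?_
    simp [Fin.sum_univ_five, dk, dpk, k]
    ring
  · refine (extD_oneForm_apply (c' := ![_, _, _, _, 0]) (Fin.forall_fin_succ.2
      ⟨((hD.const_mul 2).sub hpk).const_mul _, Fin.forall_fin_succ.2
      ⟨hqk.const_mul _, Fin.forall_fin_succ.2
      ⟨hk.const_mul _, Fin.forall_fin_succ.2 ⟨hp.const_mul _, Fin.forall_fin_one.2 (c _)⟩⟩⟩⟩)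
      v w).trans ?_
    simp [Fin.sum_univ_five, dk, dpk, dqk, dD, k]
    ring
  · refine (extD_oneForm_apply (c' := ![0, _, 0, 0, 0]) (Fin.forall_fin_succ.2
      ⟨c _, Fin.forall_fin_succ.2 ⟨hqk.const_mul _, Fin.forall_fin_succ.2
      ⟨c _, Fin.forall_fin_succ.2 ⟨c _, Fin.forall_fin_one.2 (c _)⟩⟩⟩⟩) v w).trans ?_
    simp [Fin.sum_univ_five, dk, dqk, k]
    ring
  · refine (extD_oneForm_apply (c' := ![_, _, _, 0, _]) (Fin.forall_fin_succ.2
      ⟨hpk.const_mul _, Fin.forall_fin_succ.2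
      ⟨((hD.const_mul 2).sub hqk).const_mul _, Fin.forall_fin_succ.2
      ⟨hk.const_mul _, Fin.forall_fin_succ.2 ⟨c _, Fin.forall_fin_one.2 (hq.const_mul _)⟩⟩⟩⟩)
      v w).trans ?_
    simp [Fin.sum_univ_five, dk, dpk, dqk, dD, k]
    ring

end GoursatCoframe

/-! ### The Goursat coframing satisfies (1) and generates the ideal of the equation. -/

section GoursatStructure

open Set Filter Topology

theorem goursatDensity_ne_zero {u : R5} (hu : u ∈ goursatDomain) : goursatDensity u ≠ 0 :=
  inv_ne_zero (mul_ne_zero hu.1 (Real.sqrt_pos.2 hu.2).ne')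

/-- Solving `k² (x+y)² p q = 1` for `q` eliminates the square root, and (1) becomes an identity of
rational functions of `k`, `x+y`, `p`. -/
theorem goursatDensity_sq {u : R5} (hu : u ∈ goursatDomain) :
    u 4 = (goursatDensity u ^ 2 * (u 0 + u 1) ^ 2 * u 3)⁻¹ := by
  have hsq : √(u 3 * u 4) ^ 2 = u 3 * u 4 := Real.sq_sqrt hu.2.le
  obtain ⟨h3, h4⟩ := ne_zero_of_mem_goursatDomain hu
  have hD := hu.1
  unfold goursatDensity
  rw [inv_pow, mul_pow, hsq]
  field_simp

theorem structureEquationsOn_goursatCoframe {ε : ℝ} (hε : ε = 1 ∨ ε = -1) :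
    StructureEquationsOn ε (goursatCoframe ε) goursatDomain := by
  refine structureEquationsOn_iff.2 fun u hu v w => ?_
  obtain ⟨e0, e1, e2, e3, e4⟩ := extD_goursatCoframe_apply ε hu v w
  obtain ⟨f0, f1, f2, f3, f4⟩ := covec_goursatCoframe ε u v
  obtain ⟨g0, g1, g2, g3, g4⟩ := covec_goursatCoframe ε u w
  rw [e0, e1, e2, e3, e4, f0, f1, f2, f3, f4, g0, g1, g2, g3, g4]
  have hk := goursatDensity_ne_zero hu
  have hD := hu.1
  obtain ⟨hp, -⟩ := ne_zero_of_mem_goursatDomain hu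
  have hq := goursatDensity_sq hu
  clear e0 e1 e2 e3 e4 f0 f1 f2 f3 f4 g0 g1 g2 g3 g4 hu
  generalize goursatDensity u = k at *
  generalize u 3 = p at *
  generalize u 4 = q at *
  have hx : u 0 = (u 0 + u 1) - u 1 := by ring
  generalize u 0 + u 1 = D at *
  subst hq
  rcases hε with rfl | rfl
  · refine ⟨?_, ?_, ?_, ?_, ?_⟩ <;> field_simp <;> ring
  · refine ⟨?_, ?_, ?_, ?_, ?_⟩ <;> field_simp <;> ring

theorem linearIndependent_goursatCoframe {ε : ℝ} (hε : ε = 1 ∨ ε = -1) {u : R5}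
    (hu : u ∈ goursatDomain) : LinearIndependent ℝ fun i => goursatCoframe ε i u := by
  rw [Fintype.linearIndependent_iff]
  intro g hg
  have h : ∀ v : R5, ∑ i, g i * covec (goursatCoframe ε i) u v = 0 := by
    intro v
    have h1 := congrArg (fun a : R5 [⋀^Fin 1]→L[ℝ] ℝ => a fun _ => v) hg
    refine Eq.trans ?_ h1
    exact (ContinuousAlternatingMap.sum_apply
      (fun i => g i • (goursatCoframe ε i u : R5 [⋀^Fin 1]→L[ℝ] ℝ)) _).symm
  obtain ⟨hp, hq⟩ := ne_zero_of_mem_goursatDomain hu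
  have hk := goursatDensity_ne_zero hu
  have hε0 : ε ≠ 0 := by rcases hε with rfl | rfl <;> norm_num
  have e := fun v => covec_goursatCoframe ε u v
  simp only [Fin.sum_univ_five, (e _).1, (e _).2.1, (e _).2.2.1, (e _).2.2.2.1,
    (e _).2.2.2.2] at h
  -- The matrix is triangular in this order: `∂q` and `∂p` isolate the coefficients of `σ⁴` and
  -- `σ²`, then `∂z` that of `σ⁰`, and `∂x`, `∂y` those of `σ¹`, `σ³`.
  have h4 := h (EuclideanSpace.single 4 1)
  have h3 := h (EuclideanSpace.single 3 1)
  have h2 := h (EuclideanSpace.single 2 1)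
  have h0 := h (EuclideanSpace.single 0 1)
  have h1 := h (EuclideanSpace.single 1 1)
  simp [hε0, hp, hq] at h4 h3
  simp [h4, h3, hk] at h2
  simp [h4, h3, h2, hε0, hp, hk] at h0
  simp [h4, h3, h2, hε0, hq, hk] at h1
  intro i
  fin_cases i <;> assumption

theorem goursatRHS_eq {u : R5} (hu : u ∈ goursatDomain) :
    goursatRHS (u 0) (u 1) (u 2) (u 3) (u 4) = -2 * u 3 * u 4 * goursatDensity u := by
  have hsq : √(u 3 * u 4) ^ 2 = u 3 * u 4 := Real.sq_sqrt hu.2.le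
  have hs := (Real.sqrt_pos.2 hu.2).ne'
  have hD := hu.1
  unfold goursatDensity goursatRHS
  field_simp
  linear_combination (-1) * hsq

theorem covec_coordForm (j : Fin 5) (u v : R5) : covec (coordForm j) u v = v j := rfl

theorem covec_contactForm (u v : R5) :
    covec contactForm u v = v 2 - u 3 * v 0 - u 4 * v 1 := rfl

theorem extD_contactForm_apply (u v w : R5) :
    (extD contactForm u : R5 [⋀^Fin 2]→L[ℝ] ℝ) ![v, w] =
      -(v 3 * w 0 - w 3 * v 0) - (v 4 * w 1 - w 4 * v 1) := by
  have h : contactForm = oneForm ![fun u => -u 3, fun u => -u 4, fun _ => 1, fun _ => 0,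
      fun _ => 0] := by
    ext1 u
    refine ContinuousAlternatingMap.ext fun (v : Fin 1 → R5) => ?_
    have hv : v = fun _ => v 0 := by ext i; fin_cases i; rfl
    rw [hv]
    refine (covec_contactForm u (v 0)).trans (Eq.symm ((covec_oneForm _ u (v 0)).trans ?_))
    simp [Fin.sum_univ_five]
    ring
  rw [h]
  refine (extD_oneForm_apply (c' := ![_, _, 0, 0, 0]) (Fin.forall_fin_succ.2
      ⟨(hasFDerivAt_coord 3 u).neg, Fin.forall_fin_succ.2 ⟨(hasFDerivAt_coord 4 u).neg,
      Fin.forall_fin_succ.2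
      ⟨hasFDerivAt_const _ _, Fin.forall_fin_succ.2 ⟨hasFDerivAt_const _ _,
        Fin.forall_fin_one.2 (hasFDerivAt_const _ _)⟩⟩⟩⟩) v w).trans ?_
  simp [Fin.sum_univ_five]
  ring

theorem smoothFormOn_coordForm (j : Fin 5) (U : Set R5) : SmoothFormOn (coordForm j) U :=
  smoothFormOn_self.2 fun _ _ => (contDiffAt_const : ContDiffAt ℝ ∞ (fun _ : R5 => coordAlt j) _)

theorem oneForm_congr_iff {α β : R5 [⋀^Fin 1]→L[ℝ] ℝ} :
    α = β ↔ ∀ v, α (fun _ => v) = β fun _ => v := by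
  refine ⟨fun h v => by rw [h], fun h => ?_⟩
  ext v
  have hv : v = fun _ => v 0 := by ext i; fin_cases i; rfl
  rw [hv]
  exact h _

/-- The form `(dp - F dy) ∧ dx` of the Goursat equation. -/
noncomputable def goursatForm : Form R5 2 :=
  wedge₁ (fun u => coordForm 3 u - goursatRHS (u 0) (u 1) (u 2) (u 3) (u 4) • coordForm 1 u)
    (coordForm 0)

theorem goursatForm_apply {u : R5} (hu : u ∈ goursatDomain) (v w : R5) :
    (goursatForm u : R5 [⋀^Fin 2]→L[ℝ] ℝ) ![v, w] =
      (v 3 + 2 * u 3 * u 4 * goursatDensity u * v 1) * w 0 -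
      (w 3 + 2 * u 3 * u 4 * goursatDensity u * w 1) * v 0 := by
  refine (wedge₁_apply_pair _ _ u v w).trans ?_
  change (v 3 - goursatRHS (u 0) (u 1) (u 2) (u 3) (u 4) * v 1) * w 0 -
    (w 3 - goursatRHS (u 0) (u 1) (u 2) (u 3) (u 4) * w 1) * v 0 = _
  rw [goursatRHS_eq hu]
  ring

/-- With `ω = (dp - F dy)∧dx`, one has `σ⁰ = (k/2) θ`, `σ¹∧σ² = -(k/2) ω + (pk²/2) dx∧θ` and `σ³∧σ⁴
= (k/2)(dθ + ω) + (qk²/2) dy∧θ`. Since `k ≠ 0`, these relations can be inverted with smooth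
coefficients. The form `dθ + ω = -(dq - F dx)∧dy` is the second characteristic generator. -/
theorem algIdeal_goursatCoframe_iff {ε : ℝ} (hε : ε = 1 ∨ ε = -1) {V : Set R5}
    (hV : V ⊆ goursatDomain) {k : ℕ} {β : Form R5 k} :
    AlgIdeal (coframeAlgGenerators (goursatCoframe ε)) V β ↔
      AlgIdeal (pdeGenerators goursatRHS) V β := by
  have sf : ∀ f : R5 → ℝ, (∀ u ∈ goursatDomain, ContDiffAt ℝ ∞ f u) →
      SmoothFormOn (functionForm f) V :=
    fun f hf => smoothFormOn_functionForm_self fun u hu => hf u (hV hu)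
  have dk := fun u (hu : u ∈ goursatDomain) => contDiffAt_goursatDensity hu
  have dki := fun u (hu : u ∈ goursatDomain) => (dk u hu).inv (goursatDensity_ne_zero hu)
  have c : ∀ (a : ℝ) (u : R5), ContDiffAt ℝ ∞ (fun _ : R5 => a) u := fun _ _ => contDiffAt_const
  have d := contDiffAt_coord
  constructor
  · set J := pdeGenerators goursatRHS with hJ
    have hθ : AlgIdeal J V contactForm := .of _ (Or.inl rfl)
    have hdθ : AlgIdeal J V (extD contactForm) := .of _ (Or.inr (Or.inl rfl))
    have hω : AlgIdeal J V goursatForm := .of _ (Or.inr (Or.inr rfl))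
    have hw : ∀ j, AlgIdeal J V (coordForm j ⋏ contactForm) := fun j =>
      .wedge rfl _ _ (smoothFormOn_coordForm j V) hθ
    refine fun h => h.of_generators ?_
    rintro η (rfl | rfl | rfl)
    · refine .congr _ _ (hθ.smul (sf (fun u => 1 / 2 * goursatDensity u)
        fun u hu => (c _ u).mul (dk u hu))) fun u hu => oneForm_congr_iff.2 fun v => ?_
      refine Eq.trans ?_ (covec_goursatCoframe ε u v).1.symm
      change 1 / 2 * goursatDensity u * covec contactForm u v = _
      rw [covec_contactForm]
      ring
    · refine .congr _ _ ((hω.smul (sf (fun u => -1 / 2 * goursatDensity u)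
        fun u hu => (c _ u).mul (dk u hu))).add _ _ ((hw 0).smul
          (sf (fun u => 1 / 2 * u 3 * goursatDensity u ^ 2)
        fun u hu => ((c _ u).mul (d 3 u)).mul ((dk u hu).pow 2)))) fun u hu =>
          twoForm_ext_iff.2 fun v w => ?_
      refine Eq.trans ?_ (wedge₁_apply_pair _ _ u v w).symm
      change -1 / 2 * goursatDensity u * (goursatForm u : R5 [⋀^Fin 2]→L[ℝ] ℝ) ![v, w] +
        1 / 2 * u 3 * goursatDensity u ^ 2 *
          ((coordForm 0 ⋏ contactForm) u : R5 [⋀^Fin 2]→L[ℝ] ℝ) ![v, w] = _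
      rw [goursatForm_apply (hV hu), wedge₁_apply_pair]
      obtain ⟨-, f1, f2, -, -⟩ := covec_goursatCoframe ε u v
      obtain ⟨-, g1, g2, -, -⟩ := covec_goursatCoframe ε u w
      rw [f1, f2, g1, g2]
      simp only [covec_coordForm, covec_contactForm]
      have hp := (ne_zero_of_mem_goursatDomain (hV hu)).1
      rcases hε with rfl | rfl <;> field_simp <;> ring
    · refine .congr _ _ (((hdθ.add _ _ hω).smul (sf (fun u => 1 / 2 * goursatDensity u)
        fun u hu => (c _ u).mul (dk u hu))).add _ _ ((hw 1).smul
          (sf (fun u => 1 / 2 * u 4 * goursatDensity u ^ 2)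
        fun u hu => ((c _ u).mul (d 4 u)).mul ((dk u hu).pow 2)))) fun u hu =>
          twoForm_ext_iff.2 fun v w => ?_
      refine Eq.trans ?_ (wedge₁_apply_pair _ _ u v w).symm
      change 1 / 2 * goursatDensity u * ((extD contactForm u : R5 [⋀^Fin 2]→L[ℝ] ℝ) ![v, w] +
        (goursatForm u : R5 [⋀^Fin 2]→L[ℝ] ℝ) ![v, w]) +
        1 / 2 * u 4 * goursatDensity u ^ 2 *
          ((coordForm 1 ⋏ contactForm) u : R5 [⋀^Fin 2]→L[ℝ] ℝ) ![v, w] = _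
      rw [goursatForm_apply (hV hu), wedge₁_apply_pair, extD_contactForm_apply]
      obtain ⟨-, -, -, f1, f2⟩ := covec_goursatCoframe ε u v
      obtain ⟨-, -, -, g1, g2⟩ := covec_goursatCoframe ε u w
      rw [f1, f2, g1, g2]
      simp only [covec_coordForm, covec_contactForm]
      have hq := (ne_zero_of_mem_goursatDomain (hV hu)).2
      rcases hε with rfl | rfl <;> field_simp <;> ring
  · set J := coframeAlgGenerators (goursatCoframe ε) with hJ
    have h0 : AlgIdeal J V (goursatCoframe ε 0) := .of _ (Or.inl rfl)
    have h12 : AlgIdeal J V (goursatCoframe ε 1 ⋏ goursatCoframe ε 2) := .of _ (Or.inr (Or.inl rfl))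
    have h34 : AlgIdeal J V (goursatCoframe ε 3 ⋏ goursatCoframe ε 4) := .of _ (Or.inr (Or.inr rfl))
    have hw : ∀ j, AlgIdeal J V (coordForm j ⋏ goursatCoframe ε 0) := fun j =>
      .wedge rfl _ _ (smoothFormOn_coordForm j V) h0
    have hω : AlgIdeal J V goursatForm := by
      refine .congr _ _ ((h12.smul (sf (fun u => -2 * (goursatDensity u)⁻¹)
        fun u hu => (c _ u).mul (dki u hu))).add _ _ ((hw 0).smul
          (sf (fun u => 2 * u 3) fun u hu => ((c _ u).mul (d 3 u))))) fun u hu =>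
          twoForm_ext_iff.2 fun v w => ?_
      refine Eq.trans ?_ (goursatForm_apply (hV hu) v w).symm
      change -2 * (goursatDensity u)⁻¹ *
          ((goursatCoframe ε 1 ⋏ goursatCoframe ε 2) u : R5 [⋀^Fin 2]→L[ℝ] ℝ) ![v, w] +
        2 * u 3 * ((coordForm 0 ⋏ goursatCoframe ε 0) u : R5 [⋀^Fin 2]→L[ℝ] ℝ) ![v, w] = _
      simp only [wedge₁_apply_pair]
      obtain ⟨f0, f1, f2, -, -⟩ := covec_goursatCoframe ε u v
      obtain ⟨g0, g1, g2, -, -⟩ := covec_goursatCoframe ε u w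
      rw [f0, f1, f2, g0, g1, g2]
      simp only [covec_coordForm]
      have hp := (ne_zero_of_mem_goursatDomain (hV hu)).1
      have hk := goursatDensity_ne_zero (hV hu)
      rcases hε with rfl | rfl <;> field_simp <;> ring
    refine fun h => h.of_generators ?_
    rintro η (rfl | rfl | rfl)
    · refine .congr _ _ (h0.smul (sf (fun u => 2 * (goursatDensity u)⁻¹)
        fun u hu => (c _ u).mul (dki u hu))) fun u hu => oneForm_congr_iff.2 fun v => ?_
      refine Eq.trans ?_ (covec_contactForm u v).symm
      change 2 * (goursatDensity u)⁻¹ * covec (goursatCoframe ε 0) u v = _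
      rw [(covec_goursatCoframe ε u v).1]
      have hk := goursatDensity_ne_zero (hV hu)
      field_simp
    · refine .congr _ _ ((((h34.smul (sf (fun u => 2 * (goursatDensity u)⁻¹)
        fun u hu => (c _ u).mul (dki u hu))).add _ _ ((hw 1).smul
          (sf (fun u => -2 * u 4) fun u hu => ((c _ u).mul (d 4 u)))))).sub hω) fun u hu =>
          twoForm_ext_iff.2 fun v w => ?_
      refine Eq.trans ?_ (extD_contactForm_apply u v w).symm
      change 2 * (goursatDensity u)⁻¹ *
          ((goursatCoframe ε 3 ⋏ goursatCoframe ε 4) u : R5 [⋀^Fin 2]→L[ℝ] ℝ) ![v, w] +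
        -2 * u 4 * ((coordForm 1 ⋏ goursatCoframe ε 0) u : R5 [⋀^Fin 2]→L[ℝ] ℝ) ![v, w] -
        (goursatForm u : R5 [⋀^Fin 2]→L[ℝ] ℝ) ![v, w] = _
      rw [goursatForm_apply (hV hu)]
      simp only [wedge₁_apply_pair]
      obtain ⟨f0, -, -, f1, f2⟩ := covec_goursatCoframe ε u v
      obtain ⟨g0, -, -, g1, g2⟩ := covec_goursatCoframe ε u w
      rw [f0, f1, f2, g0, g1, g2]
      simp only [covec_coordForm]
      have hq := (ne_zero_of_mem_goursatDomain (hV hu)).2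
      have hk := goursatDensity_ne_zero (hV hu)
      rcases hε with rfl | rfl <;> field_simp <;> ring
    · exact hω

theorem goursatCoframe_realizes {ε : ℝ} (hε : ε = 1 ∨ ε = -1) :
    IsCoframingOn (goursatCoframe ε) goursatDomain ∧
      StructureEquationsOn ε (goursatCoframe ε) goursatDomain ∧
      ∀ (k : ℕ) (β : Form R5 k), AlgIdeal (coframeGenerators (goursatCoframe ε)) goursatDomain β ↔
        AlgIdeal (pdeGenerators goursatRHS) goursatDomain β :=
  ⟨⟨smoothFormOn_goursatCoframe ε, fun _ => linearIndependent_goursatCoframe hε⟩,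
    structureEquationsOn_goursatCoframe hε, fun _ _ =>
      (algIdeal_coframeGenerators_iff (smoothFormOn_goursatCoframe ε)
        (structureEquationsOn_goursatCoframe hε)).trans
        (algIdeal_goursatCoframe_iff hε subset_rfl)⟩

end GoursatStructure

/-! ### Total differential systems from representations of Lie algebras. -/

section LinearSystems

open Set Filter Topology

set_option synthInstance.maxHeartbeats 200000
set_option maxSynthPendingDepth 5

variable {E : Type*} [NormedAddCommGroup E] [NormedSpace ℝ E]

/-- The exterior derivative of a field of covectors. -/
noncomputable def covecDeriv (a : E → E →L[ℝ] ℝ) (x v w : E) : ℝ :=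
  fderiv ℝ a x v w - fderiv ℝ a x w v

theorem exists_contDiffAt_of_flat {F : Type*} [NormedAddCommGroup F] [NormedSpace ℝ F]
    [CompleteSpace F] {A : E → E →L[ℝ] F →L[ℝ] F} {x₀ : E}
    (hA : ∀ᶠ x in 𝓝 x₀, ContDiffAt ℝ ∞ A x)
    (hflat : ∀ᶠ x in 𝓝 x₀, ∀ v w, fderiv ℝ A x v w - fderiv ℝ A x w v =
      (A x v).comp (A x w) - (A x w).comp (A x v)) (y₀ : F) :
    ∃ Y : E → F, Y x₀ = y₀ ∧
      ∀ᶠ x in 𝓝 x₀, ContDiffAt ℝ ∞ Y x ∧ HasFDerivAt Y ((A x).flip (Y x)) x := by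
  obtain ⟨Y, hY0, hY⟩ := exists_hasFDerivAt_of_flat
    (hA.mono fun x hx => hx.of_le (WithTop.coe_le_coe.2 le_top)) hflat y₀
  refine ⟨Y, hY0, ?_⟩
  filter_upwards [hA, hY.eventually_nhds] with x h1 h2
  exact ⟨contDiffAt_of_hasFDerivAt_flat h1 h2, h2.self_of_nhds⟩

/-- The connection is `∑ cᵢ ⊗ Nᵢ`. If the `cᵢ` satisfy Maurer–Cartan equations and the `Nᵢ`
represent the Lie algebra accordingly, then `hflat` holds. -/
theorem exists_solution_of_flat_system {ι F : Type*} [Fintype ι] [NormedAddCommGroup F]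
    [NormedSpace ℝ F] [CompleteSpace F] {c : ι → E → E →L[ℝ] ℝ} {N : ι → F →L[ℝ] F} {x₀ : E}
    (hc : ∀ i, ∀ᶠ x in 𝓝 x₀, ContDiffAt ℝ ∞ (c i) x)
    (hflat : ∀ᶠ x in 𝓝 x₀, ∀ v w y, ∑ i, covecDeriv (c i) x v w • N i y =
      ∑ i, c i x v • N i (∑ j, c j x w • N j y) - ∑ i, c i x w • N i (∑ j, c j x v • N j y))
    (y₀ : F) :
    ∃ Y : E → F, Y x₀ = y₀ ∧ ∀ᶠ x in 𝓝 x₀, ContDiffAt ℝ ∞ Y x ∧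
      HasFDerivAt Y (∑ i, (c i x).smulRight (N i (Y x))) x := by
  let S : ι → (E →L[ℝ] ℝ) →L[ℝ] E →L[ℝ] F →L[ℝ] F := fun i =>
    (ContinuousLinearMap.smulRightL ℝ E (F →L[ℝ] F)).flip (N i)
  have hS : ∀ i a v, S i a v = a v • N i := fun i a v => rfl
  have hd : ∀ᶠ x in 𝓝 x₀, HasFDerivAt (fun x => ∑ i, S i (c i x))
      (∑ i, (S i).comp (fderiv ℝ (c i) x)) x := by
    filter_upwards [eventually_all.2 hc] with x hx
    refine HasFDerivAt.fun_sum fun i _ => ?_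
    exact HasFDerivAt.comp (E := E) (F := E →L[ℝ] ℝ) (G := E →L[ℝ] F →L[ℝ] F) x
      (ContinuousLinearMap.hasFDerivAt (𝕜 := ℝ) (S i))
      ((hx i).differentiableAt (by simp)).hasFDerivAt
  obtain ⟨Y, hY0, hY⟩ := exists_contDiffAt_of_flat (A := fun x => ∑ i, S i (c i x))
    (by
      filter_upwards [eventually_all.2 hc] with x hx
      refine ContDiffAt.sum fun i _ => ?_
      exact ContDiffAt.comp (E := E) (F := E →L[ℝ] ℝ) (G := E →L[ℝ] F →L[ℝ] F) x
        (ContDiff.contDiffAt (𝕜 := ℝ) (E := E →L[ℝ] ℝ) (F := E →L[ℝ] F →L[ℝ] F)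
          (ContinuousLinearMap.contDiff (𝕜 := ℝ) (E := E →L[ℝ] ℝ)
            (F := E →L[ℝ] F →L[ℝ] F) (S i))) (hx i))
    (by
      filter_upwards [hd, hflat] with x hd hflat v w
      rw [hd.fderiv]
      ext y
      have hA : ∀ v y, (∑ i, S i (c i x)) v y = ∑ i, c i x v • N i y := fun v y => by simp [hS]
      have hD : ∀ v w y, (∑ i, (S i).comp (fderiv ℝ (c i) x)) v w y =
          ∑ i, fderiv ℝ (c i) x v w • N i y := fun v w y => by simp [hS]
      have := hflat v w y
      simp only [covecDeriv, sub_smul, Finset.sum_sub_distrib] at this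
      simp only [sub_apply, ContinuousLinearMap.comp_apply, hA, hD]
      exact this) y₀
  refine ⟨Y, hY0, hY.mono fun x hx => ⟨hx.1, hx.2.congr_fderiv ?_⟩⟩
  ext v
  simp [hS]

/-- The standard 2-dimensional representation of `sl₂`: `h` acts by `diag(-1/2, 1/2)`, `b` and `a`
by the two elementary nilpotent matrices. -/
theorem exists_sl2_solution {a b h : E → E →L[ℝ] ℝ} {x₀ : E}
    (ha : ∀ᶠ x in 𝓝 x₀, ContDiffAt ℝ ∞ a x) (hb : ∀ᶠ x in 𝓝 x₀, ContDiffAt ℝ ∞ b x)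
    (hh : ∀ᶠ x in 𝓝 x₀, ContDiffAt ℝ ∞ h x)
    (hda : ∀ᶠ x in 𝓝 x₀, ∀ v w, covecDeriv a x v w = h x v * a x w - h x w * a x v)
    (hdb : ∀ᶠ x in 𝓝 x₀, ∀ v w, covecDeriv b x v w = -(h x v * b x w - h x w * b x v))
    (hdh : ∀ᶠ x in 𝓝 x₀, ∀ v w, covecDeriv h x v w = 2 * (a x v * b x w - a x w * b x v))
    (p q : ℝ) :
    ∃ f g : E → ℝ, f x₀ = p ∧ g x₀ = q ∧ ∀ᶠ x in 𝓝 x₀, ContDiffAt ℝ ∞ f x ∧ ContDiffAt ℝ ∞ g x ∧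
      HasFDerivAt f ((-(1 / 2) * f x) • h x + g x • b x) x ∧
      HasFDerivAt g ((1 / 2 * g x) • h x + f x • a x) x := by
  let π₁ : ℝ × ℝ →L[ℝ] ℝ := ContinuousLinearMap.fst ℝ ℝ ℝ
  let π₂ : ℝ × ℝ →L[ℝ] ℝ := ContinuousLinearMap.snd ℝ ℝ ℝ
  obtain ⟨Y, hY0, hY⟩ := exists_solution_of_flat_system (c := ![h, b, a])
    (N := ![(-(1 / 2 : ℝ) • π₁).prod ((1 / 2 : ℝ) • π₂), π₂.prod 0, (0 : ℝ × ℝ →L[ℝ] ℝ).prod π₁])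
    (x₀ := x₀) (Fin.forall_fin_succ.2 ⟨hh, Fin.forall_fin_two.2 ⟨hb, ha⟩⟩)
    (by
      filter_upwards [hda, hdb, hdh] with x hda hdb hdh v w y
      refine Prod.ext ?_ ?_ <;>
        simp [Fin.sum_univ_three, hda v w, hdb v w, hdh v w, π₁, π₂] <;> ring)
    (p, q)
  refine ⟨fun x => (Y x).1, fun x => (Y x).2, by simp [hY0], by simp [hY0], ?_⟩
  filter_upwards [hY] with x hx
  refine ⟨contDiff_fst.contDiffAt.comp x hx.1, contDiff_snd.contDiffAt.comp x hx.1,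
    (hx.2.fst).congr_fderiv ?_, (hx.2.snd).congr_fderiv ?_⟩
  · ext v
    simp [Fin.sum_univ_three, π₁, π₂]
    ring
  · ext v
    simp [Fin.sum_univ_three, π₁, π₂]
    ring

/-- The same for the nonabelian 2-dimensional algebra, where `κ` scales the first component and `δ`
feeds it into the second. -/
theorem exists_affine_solution {κ δ : E → E →L[ℝ] ℝ} {x₀ : E} {ε : ℝ}
    (hκ : ∀ᶠ x in 𝓝 x₀, ContDiffAt ℝ ∞ κ x) (hδ : ∀ᶠ x in 𝓝 x₀, ContDiffAt ℝ ∞ δ x)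
    (hdκ : ∀ᶠ x in 𝓝 x₀, ∀ v w, covecDeriv κ x v w = 0)
    (hdδ : ∀ᶠ x in 𝓝 x₀, ∀ v w, covecDeriv δ x v w = -ε * (κ x v * δ x w - κ x w * δ x v))
    (p q : ℝ) :
    ∃ f g : E → ℝ, f x₀ = p ∧ g x₀ = q ∧ ∀ᶠ x in 𝓝 x₀, ContDiffAt ℝ ∞ f x ∧ ContDiffAt ℝ ∞ g x ∧
      HasFDerivAt f ((ε * f x) • κ x) x ∧ HasFDerivAt g ((-ε * f x) • δ x) x := by
  let π₁ : ℝ × ℝ →L[ℝ] ℝ := ContinuousLinearMap.fst ℝ ℝ ℝ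
  obtain ⟨Y, hY0, hY⟩ := exists_solution_of_flat_system (c := ![κ, δ])
    (N := ![(ε • π₁).prod 0, (0 : ℝ × ℝ →L[ℝ] ℝ).prod (-ε • π₁)])
    (x₀ := x₀) (Fin.forall_fin_two.2 ⟨hκ, hδ⟩)
    (by
      filter_upwards [hdκ, hdδ] with x hdκ hdδ v w y
      refine Prod.ext ?_ ?_
      · simp [Fin.sum_univ_two, hdκ v w, hdδ v w, π₁]
        ring
      · simp [Fin.sum_univ_two, hdκ v w, hdδ v w, π₁]
        ring)
    (p, q)
  refine ⟨fun x => (Y x).1, fun x => (Y x).2, by simp [hY0], by simp [hY0], ?_⟩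
  filter_upwards [hY] with x hx
  refine ⟨contDiff_fst.contDiffAt.comp x hx.1, contDiff_snd.contDiffAt.comp x hx.1,
    (hx.2.fst).congr_fderiv ?_, (hx.2.snd).congr_fderiv ?_⟩
  · ext v
    simp [Fin.sum_univ_two, π₁]
    ring
  · ext v
    simp [Fin.sum_univ_two, π₁]
    ring

end LinearSystems

/-! ### Goursat coordinates for an arbitrary coframing that satisfies (1). -/

section GoursatCoordinates

open Set Filter Topology

variable {E : Type*} [NormedAddCommGroup E] [NormedSpace ℝ E]

theorem hasFDerivAt_div {f g : E → ℝ} {f' g' : E →L[ℝ] ℝ} {x : E} (hf : HasFDerivAt f f' x)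
    (hg : HasFDerivAt g g' x) (h0 : g x ≠ 0) :
    HasFDerivAt (fun y => f y / g y) (((g x) ^ 2)⁻¹ • (g x • f' - f x • g')) x := by
  simp only [div_eq_mul_inv]
  refine (hf.mul ((hasDerivAt_inv h0).comp_hasFDerivAt x hg)).congr_fderiv ?_
  ext v
  simp
  field_simp
  ring

theorem eventually_eq_of_hasFDerivAt_zero {f : E → ℝ} {x₀ : E}
    (hf : ∀ᶠ x in 𝓝 x₀, HasFDerivAt f (0 : E →L[ℝ] ℝ) x) : ∀ᶠ x in 𝓝 x₀, f x = f x₀ := by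
  obtain ⟨r, hr, h⟩ := Metric.eventually_nhds_iff_ball.1 hf
  filter_upwards [Metric.ball_mem_nhds x₀ hr] with x hx
  exact Metric.isOpen_ball.is_const_of_fderiv_eq_zero (convex_ball x₀ r).isPreconnected
    (fun y hy => (h y hy).differentiableAt.differentiableWithinAt) (fun y hy => (h y hy).fderiv)
    hx (Metric.mem_ball_self hr)

/-- The structure equations for covector fields `s i` at a point of a normed space. -/
def CovecStructureEquations (ε : ℝ) (s : Fin 5 → E → E →L[ℝ] ℝ) (x : E) : Prop :=
  ∀ v w : E,
    covecDeriv (s 0) x v w = -ε * (s 0 x v * (s 2 x w - s 4 x w) - s 0 x w * (s 2 x v - s 4 x v)) +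
      (s 1 x v * s 2 x w - s 1 x w * s 2 x v) + (s 3 x v * s 4 x w - s 3 x w * s 4 x v) ∧
    covecDeriv (s 1) x v w = ε * (s 1 x v * (s 2 x w + s 3 x w + s 4 x w) -
      s 1 x w * (s 2 x v + s 3 x v + s 4 x v)) ∧
    covecDeriv (s 2) x v w = s 0 x v * (s 2 x w - s 4 x w) - s 0 x w * (s 2 x v - s 4 x v) -
      ε * ((s 1 x v - s 3 x v) * s 2 x w - (s 1 x w - s 3 x w) * s 2 x v) ∧
    covecDeriv (s 3) x v w = -ε * (s 3 x v * (s 1 x w + s 2 x w + s 4 x w) -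
      s 3 x w * (s 1 x v + s 2 x v + s 4 x v)) ∧
    covecDeriv (s 4) x v w = -(s 0 x v * (s 2 x w - s 4 x w) - s 0 x w * (s 2 x v - s 4 x v)) -
      ε * ((s 1 x v - s 3 x v) * s 4 x w - (s 1 x w - s 3 x w) * s 4 x v)

theorem covecDeriv_linearCombination {c : Fin 5 → ℝ} {s : Fin 5 → E → E →L[ℝ] ℝ} {x : E}
    (hs : ∀ i, DifferentiableAt ℝ (s i) x) (v w : E) :
    covecDeriv (fun x => ∑ i, c i • s i x) x v w = ∑ i, c i * covecDeriv (s i) x v w := by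
  have h : HasFDerivAt (fun x => ∑ i, c i • s i x) (∑ i, c i • fderiv ℝ (s i) x) x :=
    HasFDerivAt.fun_sum fun i _ => (hs i).hasFDerivAt.const_smul (c i)
  simp only [covecDeriv, h.fderiv, sum_apply, smul_apply, smul_eq_mul, mul_sub,
    Finset.sum_sub_distrib]

theorem contDiffAt_linearCombination {c : Fin 5 → ℝ} {s : Fin 5 → E → E →L[ℝ] ℝ} {x : E}
    (hs : ∀ i, ContDiffAt ℝ ∞ (s i) x) : ContDiffAt ℝ ∞ (fun x => ∑ i, c i • s i x) x :=
  ContDiffAt.sum fun i _ => (hs i).const_smul (c i)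

/-- Integrating both Lie algebra factors gives functions with `dx = a/v₂²`, `dy = b/u₂²` and `dz =
-ε r (κ + δ)`. The Wronskian condition gives `x + y = -1/(u₂v₂)`, whence the density is `1/r`, and
the five forms can be compared one by one. -/
theorem exists_goursat_coordinates {ε : ℝ} (hε : ε = 1 ∨ ε = -1)
    {s : Fin 5 → E → E →L[ℝ] ℝ} {x₀ : E} (hs : ∀ᶠ x in 𝓝 x₀, ∀ i, ContDiffAt ℝ ∞ (s i) x)
    (hd : ∀ᶠ x in 𝓝 x₀, CovecStructureEquations ε s x) :
    ∃ Ψ : E → R5, ∀ᶠ x in 𝓝 x₀, ContDiffAt ℝ ∞ Ψ x ∧ Ψ x ∈ goursatDomain ∧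
      ∀ i v, covec (goursatCoframe ε i) (Ψ x) (fderiv ℝ Ψ x v) = s i x v := by
  have hε2 : ε * ε = 1 := by rcases hε with h | h <;> simp [h]
  let comb : (Fin 5 → ℝ) → E → E →L[ℝ] ℝ := fun c x => ∑ i, c i • s i x
  have hcomb : ∀ c, ∀ᶠ x in 𝓝 x₀, ContDiffAt ℝ ∞ (comb c) x := fun c =>
    hs.mono fun x hx => contDiffAt_linearCombination hx
  have hcombd : ∀ c, ∀ᶠ x in 𝓝 x₀, ∀ v w,
      covecDeriv (comb c) x v w = ∑ i, c i * covecDeriv (s i) x v w := fun c =>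
    hs.mono fun x hx => covecDeriv_linearCombination fun i => (hx i).differentiableAt (by simp)
  have hcomba : ∀ c x v, comb c x v = ∑ i, c i * s i x v := fun c x v => by simp [comb]
  -- The coefficient vectors are those of `a`, `b`, `h` (the `sl₂` part) and of `κ`, `δ` (the affine
  -- part).
  have hca := hcomb ![0, -ε, 0, 0, 0]
  have hda := hcombd ![0, -ε, 0, 0, 0]
  have haa := hcomba ![0, -ε, 0, 0, 0]
  have hcb := hcomb ![0, 0, 0, ε, 0]
  have hdb := hcombd ![0, 0, 0, ε, 0]
  have hab := hcomba ![0, 0, 0, ε, 0]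
  have hch := hcomb ![0, -ε, -ε, -ε, -ε]
  have hdh := hcombd ![0, -ε, -ε, -ε, -ε]
  have hah := hcomba ![0, -ε, -ε, -ε, -ε]
  have hck := hcomb ![-2 * ε, 1, -1, -1, 1]
  have hdk := hcombd ![-2 * ε, 1, -1, -1, 1]
  have hak := hcomba ![-2 * ε, 1, -1, -1, 1]
  have hcl := hcomb ![0, 0, 1, 0, -1]
  have hdl := hcombd ![0, 0, 1, 0, -1]
  have hal := hcomba ![0, 0, 1, 0, -1]
  generalize comb ![0, -ε, 0, 0, 0] = a at hca hda haa
  generalize comb ![0, 0, 0, ε, 0] = b at hcb hdb hab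
  generalize comb ![0, -ε, -ε, -ε, -ε] = h at hch hdh hah
  generalize comb ![-2 * ε, 1, -1, -1, 1] = κ at hck hdk hak
  generalize comb ![0, 0, 1, 0, -1] = δ at hcl hdl hal
  simp [Fin.sum_univ_five] at haa hab hah hak hal hda hdb hdh hdk hdl
  have eda : ∀ᶠ x in 𝓝 x₀, ∀ v w, covecDeriv a x v w = h x v * a x w - h x w * a x v := by
    filter_upwards [hda, hd] with x h1 h2 v w
    obtain ⟨e0, e1, e2, e3, e4⟩ := h2 v w
    rw [h1, e1]
    simp only [haa, hah]
    ring
  have edb : ∀ᶠ x in 𝓝 x₀, ∀ v w, covecDeriv b x v w = -(h x v * b x w - h x w * b x v) := by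
    filter_upwards [hdb, hd] with x h1 h2 v w
    obtain ⟨e0, e1, e2, e3, e4⟩ := h2 v w
    rw [h1, e3]
    simp only [hab, hah]
    ring
  have edh : ∀ᶠ x in 𝓝 x₀, ∀ v w,
      covecDeriv h x v w = 2 * (a x v * b x w - a x w * b x v) := by
    filter_upwards [hdh, hd] with x h1 h2 v w
    obtain ⟨e0, e1, e2, e3, e4⟩ := h2 v w
    rw [h1, e1, e2, e3, e4]
    simp only [haa, hab]
    ring
  have edk : ∀ᶠ x in 𝓝 x₀, ∀ v w, covecDeriv κ x v w = 0 := by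
    filter_upwards [hdk, hd] with x h1 h2 v w
    obtain ⟨e0, e1, e2, e3, e4⟩ := h2 v w
    rw [h1, e0, e1, e2, e3, e4]
    linear_combination (2 * (s 0 x v * (s 2 x w - s 4 x w) - s 0 x w * (s 2 x v - s 4 x v))) * hε2
  have edl : ∀ᶠ x in 𝓝 x₀, ∀ v w,
      covecDeriv δ x v w = -ε * (κ x v * δ x w - κ x w * δ x v) := by
    filter_upwards [hdl, hd] with x h1 h2 v w
    obtain ⟨e0, e1, e2, e3, e4⟩ := h2 v w
    rw [h1, e2, e4]
    simp only [hak, hal]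
    linear_combination (-2 * (s 0 x v * (s 2 x w - s 4 x w) - s 0 x w * (s 2 x v - s 4 x v))) * hε2
  -- The initial values `(1, 0)` and `(-1, 1)` have Wronskian 1 and make `u₂ < 0 < v₂`, which fixes
  -- the sign of the square root later on.
  obtain ⟨u₁, v₁, hu₁, hv₁, h₁⟩ := exists_sl2_solution hca hcb hch eda edb edh 1 0
  obtain ⟨u₂, v₂, hu₂, hv₂, h₂⟩ := exists_sl2_solution hca hcb hch eda edb edh (-1) 1
  obtain ⟨r, w, hr, hw, h₃⟩ := exists_affine_solution hck hcl edk edl 1 0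
  -- The representation is trace-free, so the Wronskian is locally constant.
  have hW : ∀ᶠ x in 𝓝 x₀, u₁ x * v₂ x - u₂ x * v₁ x = 1 := by
    have := eventually_eq_of_hasFDerivAt_zero (f := fun x => u₁ x * v₂ x - u₂ x * v₁ x)
      (x₀ := x₀) (by
        filter_upwards [h₁, h₂] with x h₁ h₂
        refine ((h₁.2.2.1.mul h₂.2.2.2).sub (h₂.2.2.1.mul h₁.2.2.2)).congr_fderiv ?_
        ext v
        simp
        ring)
    simpa [hu₁, hv₁, hu₂, hv₂] using this
  have hpos : ∀ᶠ x in 𝓝 x₀, u₂ x < 0 ∧ 0 < v₂ x ∧ 0 < r x := by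
    refine (h₂.self_of_nhds.1.continuousAt.eventually_lt_const (by simp [hu₂])).and
      ((h₂.self_of_nhds.2.1.continuousAt.eventually_const_lt (by simp [hv₂])).and
        (h₃.self_of_nhds.1.continuousAt.eventually_const_lt (by simp [hr])))
  let Ψ : E → R5 := fun x =>
    WithLp.toLp 2 ![v₁ x / v₂ x, -(u₁ x / u₂ x), w x - r x, r x * v₂ x ^ 2, r x * u₂ x ^ 2]
  refine ⟨Ψ, ?_⟩
  filter_upwards [h₁, h₂, h₃, hW, hpos] with x h₁ h₂ h₃ hW hpos
  obtain ⟨cu₁, cv₁, du₁, dv₁⟩ := h₁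
  obtain ⟨cu₂, cv₂, du₂, dv₂⟩ := h₂
  obtain ⟨cr, cw, dr, dw⟩ := h₃
  obtain ⟨pu, pv, pr⟩ := hpos
  have huv : u₂ x * v₂ x < 0 := mul_neg_of_neg_of_pos pu pv
  have hu0 := pu.ne
  have hv0 := pv.ne'
  have hr0 := pr.ne'
  have hΨ : ContDiffAt ℝ ∞ Ψ x := by
    refine contDiffAt_euclidean.2 fun j => ?_
    fin_cases j
    · exact cv₁.div cv₂ hv0
    · exact (cu₁.div cu₂ hu0).neg
    · exact cw.sub cr
    · exact cr.mul (cv₂.pow 2)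
    · exact cr.mul (cu₂.pow 2)
  have hsum : v₁ x / v₂ x + -(u₁ x / u₂ x) = -(u₂ x * v₂ x)⁻¹ := by
    field_simp
    linear_combination -hW
  -- The minus sign comes from `r > 0` and `u₂v₂ < 0`.
  have hsqrt : √(r x * v₂ x ^ 2 * (r x * u₂ x ^ 2)) = -(r x * (u₂ x * v₂ x)) := by
    rw [show r x * v₂ x ^ 2 * (r x * u₂ x ^ 2) = (-(r x * (u₂ x * v₂ x))) ^ 2 by ring]
    exact Real.sqrt_sq (by nlinarith)
  have hdens : goursatDensity (Ψ x) = (r x)⁻¹ := by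
    change ((v₁ x / v₂ x + -(u₁ x / u₂ x)) * √(r x * v₂ x ^ 2 * (r x * u₂ x ^ 2)))⁻¹ = _
    rw [hsum, hsqrt]
    field_simp
  have hdom : Ψ x ∈ goursatDomain := by
    refine ⟨?_, ?_⟩
    · change v₁ x / v₂ x + -(u₁ x / u₂ x) ≠ 0
      rw [hsum]
      exact neg_ne_zero.2 (inv_ne_zero huv.ne)
    · change 0 < r x * v₂ x ^ 2 * (r x * u₂ x ^ 2)
      positivity
  refine ⟨hΨ, hdom, fun i v => ?_⟩
  have hcomp : ∀ (j : Fin 5) (f' : E →L[ℝ] ℝ), HasFDerivAt (fun y => Ψ y j) f' x →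
      fderiv ℝ Ψ x v j = f' v := by
    intro j f' hf'
    have h1 := (hasFDerivAt_coord j (Ψ x)).comp x (hΨ.differentiableAt (by simp)).hasFDerivAt
    exact congrArg (fun L : E →L[ℝ] ℝ => L v) (h1.unique hf')
  have d0 : fderiv ℝ Ψ x v 0 = a x v / v₂ x ^ 2 := by
    rw [hcomp 0 _ (hasFDerivAt_div dv₁ dv₂ hv0)]
    simp
    field_simp
    linear_combination (2 * a x v) * hW
  have d1 : fderiv ℝ Ψ x v 1 = b x v / u₂ x ^ 2 := by
    rw [hcomp 1 _ (hasFDerivAt_div du₁ du₂ hu0).fun_neg]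
    simp
    field_simp
    linear_combination (2 * b x v) * hW
  have d2 : fderiv ℝ Ψ x v 2 = -(ε * r x) * (κ x v + δ x v) := by
    rw [hcomp 2 _ (dw.fun_sub dr)]
    simp
    ring
  have d3 : fderiv ℝ Ψ x v 3 =
      r x * v₂ x * (ε * κ x v * v₂ x + h x v * v₂ x + 2 * u₂ x * a x v) := by
    rw [hcomp 3 _ (dr.fun_mul (dv₂.pow 2))]
    simp
    ring
  have d4 : fderiv ℝ Ψ x v 4 =
      r x * u₂ x * (ε * κ x v * u₂ x - h x v * u₂ x + 2 * v₂ x * b x v) := by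
    rw [hcomp 4 _ (dr.fun_mul (du₂.pow 2))]
    simp
    ring
  obtain ⟨t0, t1, t2, t3, t4⟩ := covec_goursatCoframe ε (Ψ x) (fderiv ℝ Ψ x v)
  rw [hdens, d0, d1, d2] at t0
  rw [hdens, d0] at t1
  rw [hdens, d0, d1, d2, d3] at t2
  rw [hdens, d1] at t3
  rw [hdens, d0, d1, d2, d4] at t4
  have e0 : Ψ x 0 + Ψ x 1 = -(u₂ x * v₂ x)⁻¹ := hsum
  have e3 : Ψ x 3 = r x * v₂ x ^ 2 := rfl
  have e4 : Ψ x 4 = r x * u₂ x ^ 2 := rfl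
  rw [e0] at t2 t4
  rw [e3, e4] at t0 t2 t4
  rw [e3] at t1
  rw [e4] at t3
  rw [haa, hab, hak, hal] at t0 t2 t4
  rw [haa] at t1
  rw [hab] at t3
  rw [hah] at t2 t4
  fin_cases i
  · refine t0.trans ?_
    change _ = s 0 x v
    field_simp
    linear_combination (2 * s 0 x v) * hε2
  · refine t1.trans ?_
    change _ = s 1 x v
    field_simp
    linear_combination (s 1 x v) * hε2
  · refine t2.trans ?_
    change _ = s 2 x v
    field_simp
    linear_combination (2 * v₂ x * s 2 x v) * hε2
  · refine t3.trans ?_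
    change _ = s 3 x v
    field_simp
    linear_combination (s 3 x v) * hε2
  · refine t4.trans ?_
    change _ = s 4 x v
    field_simp
    linear_combination (2 * u₂ x * s 4 x v) * hε2

end GoursatCoordinates

/-! ### Matching coframings give contact equivalences. -/

section ContactEquivalence

open Set Filter Topology

variable {M : Type*} [TopologicalSpace M] [ChartedSpace R5 M]
variable {N : Type*} [TopologicalSpace N] [ChartedSpace R5 N]

theorem AlgIdeal.pullback_coframeAlgGenerators {σ : Fin 5 → Form M 1} {τ : Fin 5 → Form N 1}
    {U : Set M} {φ : M → N} (h : ∀ m ∈ U, ∀ i, formPullback φ (τ i) m = σ i m) :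
    ∀ η ∈ coframeAlgGenerators τ, AlgIdeal (coframeAlgGenerators σ) U (formPullback φ η.2) := by
  have hw : ∀ i j, ∀ m ∈ U, (σ i ⋏ σ j) m = formPullback φ (τ i ⋏ τ j) m := by
    intro i j m hm
    refine Eq.trans ?_ (congrFun (formPullback_wedge (rfl : 1 + 1 = 2) φ (τ i) (τ j)) m).symm
    change altWedge (V := R5) _ _ _ = altWedge (V := R5) _ _ _
    rw [h m hm i, h m hm j]
  rintro η (rfl | rfl | rfl)
  · exact (AlgIdeal.of (σ 0) (by simp [coframeAlgGenerators])).congr _ _ fun m hm => (h m hm 0).symm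
  · exact (AlgIdeal.of (σ 1 ⋏ σ 2) (by simp [coframeAlgGenerators])).congr _ _ (hw 1 2)
  · exact (AlgIdeal.of (σ 3 ⋏ σ 4) (by simp [coframeAlgGenerators])).congr _ _ (hw 3 4)

theorem formPullback_invFun_of_formPullback [IsManifold 𝓘(ℝ, R5) ∞ M] [IsManifold 𝓘(ℝ, R5) ∞ N]
    (φ : PartialDiffeomorph 𝓘(ℝ, R5) 𝓘(ℝ, R5) M N ∞) {k : ℕ} {α : Form M k} {β : Form N k}
    (h : ∀ m ∈ φ.source, formPullback φ.toFun β m = α m) {n : N} (hn : n ∈ φ.target) :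
    formPullback φ.invFun α n = β n := by
  have hm : φ.invFun n ∈ φ.source := φ.map_target' hn
  have h1 : MDifferentiableAt 𝓘(ℝ, R5) 𝓘(ℝ, R5) φ.invFun n :=
    (φ.contMDiffOn_invFun.contMDiffAt (φ.open_target.mem_nhds hn)).mdifferentiableAt (by simp)
  have h2 : MDifferentiableAt 𝓘(ℝ, R5) 𝓘(ℝ, R5) φ.toFun (φ.invFun n) :=
    (φ.contMDiffOn_toFun.contMDiffAt (φ.open_source.mem_nhds hm)).mdifferentiableAt (by simp)
  have h3 : φ.toFun ∘ φ.invFun =ᶠ[𝓝 n] id := by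
    filter_upwards [φ.open_target.mem_nhds hn] with y hy using φ.right_inv' hy
  have h4 : formPullback φ.invFun α n = formPullback φ.invFun (formPullback φ.toFun β) n := by
    unfold formPullback at h ⊢
    rw [h _ hm]
  rw [h4, ← formPullback_comp β h1 h2, formPullback_congr β h3, formPullback_id]

/-- Both ideals are generated algebraically by the same expressions in their coframings, and `φ` and
its inverse carry one coframing to the other. -/
theorem isContactEquivalence_of_formPullback [IsManifold 𝓘(ℝ, R5) ∞ M] {ε : ℝ}
    (hε : ε = 1 ∨ ε = -1) {σ : Fin 5 → Form M 1}
    (φ : PartialDiffeomorph 𝓘(ℝ, R5) 𝓘(ℝ, R5) M R5 ∞) (hσ : ∀ i, SmoothFormOn (σ i) φ.source)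
    (hs : StructureEquationsOn ε σ φ.source) (hφ : φ.target ⊆ goursatDomain)
    (h : ∀ m ∈ φ.source, ∀ i, formPullback φ.toFun (goursatCoframe ε i) m = σ i m) :
    IsContactEquivalence φ (coframeGenerators σ) (pdeGenerators goursatRHS) := by
  constructor
  · intro k β hβ
    exact (algIdeal_coframeGenerators_iff hσ hs).2
      (((algIdeal_goursatCoframe_iff hε hφ).2 hβ).pullback φ.open_source φ.contMDiffOn_toFun
        (fun _ hm => φ.map_source' hm) (AlgIdeal.pullback_coframeAlgGenerators h))
  · intro k η hη
    exact (algIdeal_goursatCoframe_iff hε hφ).1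
      (((algIdeal_coframeGenerators_iff hσ hs).1 hη).pullback φ.open_target φ.contMDiffOn_invFun
        (fun _ hm => φ.map_target' hm) (AlgIdeal.pullback_coframeAlgGenerators fun n hn i =>
          formPullback_invFun_of_formPullback φ (fun m hm => h m hm i) hn))

end ContactEquivalence

/-! ### Transfer to manifolds through a chart, and the inverse function theorem. -/

section ChartCoframe

open Set Filter Topology

variable {M : Type*} [TopologicalSpace M] [ChartedSpace R5 M]

/-- 1-forms on `ℝ⁵` as covectors. -/
noncomputable def covecLIE : (R5 [⋀^Fin 1]→L[ℝ] ℝ) ≃ₗᵢ[ℝ] (R5 →L[ℝ] ℝ) :=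
  (ContinuousAlternatingMap.ofSubsingletonLIE (0 : Fin 1)).symm

/-- Five independent covectors span the 5-dimensional dual space, so a vector that all of them
annihilate has zero coordinates. -/
theorem eq_zero_of_covec_eq_zero {σ : Fin 5 → Form M 1} {m : M}
    (h : LinearIndependent ℝ fun i => σ i m) {v : R5} (hv : ∀ i, covec (σ i) m v = 0) : v = 0 := by
  let ev : Module.Dual ℝ R5 →ₗ[ℝ] ℝ := Module.Dual.eval ℝ R5 v
  let f : (R5 [⋀^Fin 1]→L[ℝ] ℝ) →ₗ[ℝ] Module.Dual ℝ R5 :=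
    ContinuousLinearMap.coeLM ℝ ∘ₗ (covecLIE.toLinearEquiv : _ →ₗ[ℝ] R5 →L[ℝ] ℝ)
  have hf : Function.Injective f :=
    ContinuousLinearMap.coe_injective.comp covecLIE.injective
  have h' : LinearIndependent ℝ fun i => f (σ i m) :=
    LinearIndependent.map' (M := R5 [⋀^Fin 1]→L[ℝ] ℝ) (v := fun i => σ i m) h f
      (LinearMap.ker_eq_bot.2 hf)
  have hspan := h'.span_eq_top_of_card_eq_finrank (by simp [Subspace.dual_finrank_eq])
  have hle : Submodule.span ℝ (range fun i => f (σ i m)) ≤ LinearMap.ker ev := by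
    refine Submodule.span_le.2 ?_
    rintro _ ⟨i, rfl⟩
    exact hv i
  rw [hspan] at hle
  ext j
  exact hle (Submodule.mem_top (x := ((EuclideanSpace.proj j : R5 →L[ℝ] ℝ) : R5 →ₗ[ℝ] ℝ)))

/-- The covector fields on `ℝ⁵` that express a family of 1-forms in the chart at `m`. -/
noncomputable def chartCovec (σ : Fin 5 → Form M 1) (m : M) (i : Fin 5) (x : R5) : R5 →L[ℝ] ℝ :=
  covecLIE (inChart (σ i) m x)

theorem chartCovec_apply (σ : Fin 5 → Form M 1) (m : M) (i : Fin 5) (x v : R5) :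
    chartCovec σ m i x v = covec (σ i) ((chartAt R5 m).symm x)
      (mfderiv 𝓘(ℝ, R5) 𝓘(ℝ, R5) (chartAt R5 m).symm x v) := rfl

variable [IsManifold 𝓘(ℝ, R5) ∞ M] {σ : Fin 5 → Form M 1} {m : M} {x : R5}

theorem contDiffAt_chartCovec (hσ : ∀ i, SmoothFormOn (σ i) univ)
    (hx : x ∈ (chartAt R5 m).target) (i : Fin 5) : ContDiffAt ℝ ∞ (chartCovec σ m i) x := by
  have h := (hσ i).contDiffAt_inChart ((chartAt R5 m).map_target hx) (mem_univ _)
  rw [(chartAt R5 m).right_inv hx] at h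
  exact covecLIE.contDiff.contDiffAt.comp x h

theorem covecDeriv_chartCovec (hσ : ∀ i, SmoothFormOn (σ i) univ)
    (hx : x ∈ (chartAt R5 m).target) (i : Fin 5) (v w : R5) :
    covecDeriv (chartCovec σ m i) x v w =
      (extD (σ i) ((chartAt R5 m).symm x) : R5 [⋀^Fin 2]→L[ℝ] ℝ)
        ![mfderiv 𝓘(ℝ, R5) 𝓘(ℝ, R5) (chartAt R5 m).symm x v,
          mfderiv 𝓘(ℝ, R5) 𝓘(ℝ, R5) (chartAt R5 m).symm x w] := by
  have hm := (chartAt R5 m).map_target hx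
  have hxr := (chartAt R5 m).right_inv hx
  have h1 := (hσ i).contDiffAt_inChart hm (mem_univ _)
  have h2 := (hσ i).extDeriv_inChart hm (mem_univ _)
  rw [hxr] at h1 h2
  have h3 := extDeriv_one_apply (h1.differentiableAt (by simp)) ![v, w]
  have hd := (contDiffAt_chartCovec hσ hx i).differentiableAt (by simp)
  have h4 : ∀ v w, fderiv ℝ (fun y => (inChart (σ i) m y : R5 [⋀^Fin 1]→L[ℝ] ℝ) fun _ => w) x v =
      fderiv ℝ (chartCovec σ m i) x v w := by
    intro v w
    have := hd.hasFDerivAt.clm_apply (hasFDerivAt_const w x)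
    refine (congrArg (fun L : R5 →L[ℝ] ℝ => L v) this.fderiv).trans ?_
    simp
  rw [h2] at h3
  have h5 : inChart (extD (σ i)) m x ![v, w] =
      (extD (σ i) ((chartAt R5 m).symm x) : R5 [⋀^Fin 2]→L[ℝ] ℝ)
        ![mfderiv 𝓘(ℝ, R5) 𝓘(ℝ, R5) (chartAt R5 m).symm x v,
          mfderiv 𝓘(ℝ, R5) 𝓘(ℝ, R5) (chartAt R5 m).symm x w] := by
    refine congrArg (extD (σ i) ((chartAt R5 m).symm x) : R5 [⋀^Fin 2]→L[ℝ] ℝ) ?_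
    ext j
    fin_cases j <;> rfl
  rw [← h5, h3]
  exact congrArg₂ (· - ·) (h4 v w).symm (h4 w v).symm

theorem covecStructureEquations_chartCovec {ε : ℝ} (hσ : ∀ i, SmoothFormOn (σ i) univ)
    (hs : StructureEquationsOn ε σ univ) (hx : x ∈ (chartAt R5 m).target) :
    CovecStructureEquations ε (chartCovec σ m) x := by
  intro v w
  simp only [covecDeriv_chartCovec hσ hx, chartCovec_apply]
  exact structureEquationsOn_iff.1 hs _ (mem_univ _) _ _

theorem eq_zero_of_chartCovec_eq_zero (h : ∀ m, LinearIndependent ℝ fun i => σ i m)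
    (hx : x ∈ (chartAt R5 m).target) {v : R5} (hv : ∀ i, chartCovec σ m i x v = 0) : v = 0 := by
  have h1 := eq_zero_of_covec_eq_zero (h ((chartAt R5 m).symm x)) hv
  have h2 := (mdifferentiable_chart (I := 𝓘(ℝ, R5)) m).comp_symm_deriv hx
  have h3 := congrArg (fun L : R5 →L[ℝ] R5 => L v) h2
  refine h3.symm.trans ?_
  exact (congrArg (mfderiv 𝓘(ℝ, R5) 𝓘(ℝ, R5) (chartAt R5 m) ((chartAt R5 m).symm x)) h1).trans
    (map_zero _)

theorem exists_contactEquivalence_goursat {ε : ℝ} (hε : ε = 1 ∨ ε = -1)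
    (hσ : IsCoframingOn σ univ) (hs : StructureEquationsOn ε σ univ) (m : M) :
    ∃ φ : PartialDiffeomorph 𝓘(ℝ, R5) 𝓘(ℝ, R5) M R5 ∞,
      m ∈ φ.source ∧ φ.target ⊆ goursatDomain ∧
      IsContactEquivalence φ (coframeGenerators σ) (pdeGenerators goursatRHS) := by
  set c := chartAt R5 m with hc
  have hm : m ∈ c.source := mem_chart_source R5 m
  have ht : ∀ᶠ x in 𝓝 (c m), x ∈ c.target := c.open_target.mem_nhds (c.map_source hm)
  obtain ⟨Ψ, hΨ⟩ := exists_goursat_coordinates hε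
    (ht.mono fun x hx i => contDiffAt_chartCovec hσ.1 hx i)
    (ht.mono fun x hx => covecStructureEquations_chartCovec hσ.1 hs hx)
  obtain ⟨G, hG, hGo, hmG⟩ := eventually_nhds_iff.1 (hΨ.and ht)
  -- A kernel vector of the derivative is annihilated by the given coframing, since `Ψ` pulls the
  -- Goursat coframing back to it. Invertibility on all of `G` is needed for the local inverse to be
  -- smooth on the whole target, not just at one point.
  have hinj : ∀ x ∈ G, ∃ L : R5 ≃L[ℝ] R5, HasFDerivAt Ψ (L : R5 →L[ℝ] R5) x := by
    intro x hx
    obtain ⟨⟨h1, -, h3⟩, h4⟩ := hG x hx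
    have hi : Function.Injective (fderiv ℝ Ψ x).toLinearMap := by
      refine (injective_iff_map_eq_zero _).2 fun v hv => ?_
      refine eq_zero_of_chartCovec_eq_zero (fun m => hσ.2 m (mem_univ m)) h4 fun i => ?_
      rw [← h3 i v]
      refine (congrArg (covec (goursatCoframe ε i) (Ψ x)) hv).trans ?_
      exact ((covecLIE (goursatCoframe ε i (Ψ x))).map_zero)
    refine ⟨(LinearEquiv.ofInjectiveEndo _ hi).toContinuousLinearEquiv, ?_⟩
    refine (h1.differentiableAt (by simp)).hasFDerivAt.congr_fderiv ?_
    ext v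
    rfl
  obtain ⟨L, hL⟩ := hinj _ hmG
  have hΨ0 := (hG _ hmG).1.1
  let e := hΨ0.toOpenPartialHomeomorph Ψ hL (by simp)
  have he : ∀ x, e x = Ψ x := fun x => rfl
  -- Restricting to `G` keeps every point where the pullback identity and the invertibility of the
  -- derivative hold.
  let E := c.trans (e.restrOpen G hGo)
  have hE : ∀ m' ∈ E.source, m' ∈ c.source ∧ c m' ∈ G := by
    intro m' hm'
    simp [E] at hm'
    tauto
  have hEt : ∀ y ∈ E.target, y ∈ e.target ∧ e.symm y ∈ G ∧ e.symm y ∈ c.target := by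
    intro y hy
    simp [E] at hy
    tauto
  have hEsm : ContMDiffOn 𝓘(ℝ, R5) 𝓘(ℝ, R5) ∞ E E.source := by
    intro m' hm'
    obtain ⟨h1, h2⟩ := hE m' hm'
    have h3 : ContMDiffAt 𝓘(ℝ, R5) 𝓘(ℝ, R5) ∞ c m' :=
      contMDiffOn_chart.contMDiffAt (c.open_source.mem_nhds h1)
    exact ((hG _ h2).1.1.contMDiffAt.comp m' h3).contMDiffWithinAt
  have hEsym : ContMDiffOn 𝓘(ℝ, R5) 𝓘(ℝ, R5) ∞ E.symm E.target := by
    intro y hy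
    obtain ⟨h1, h2, h3⟩ := hEt y hy
    obtain ⟨L', hL'⟩ := hinj _ h2
    have h4 : ContDiffAt ℝ ∞ e.symm y := e.contDiffAt_symm h1 hL' (hG _ h2).1.1
    have h5 : ContMDiffAt 𝓘(ℝ, R5) 𝓘(ℝ, R5) ∞ c.symm (e.symm y) :=
      contMDiffOn_chart_symm.contMDiffAt (c.open_target.mem_nhds h3)
    exact (h5.comp y h4.contMDiffAt).contMDiffWithinAt
  let φ : PartialDiffeomorph 𝓘(ℝ, R5) 𝓘(ℝ, R5) M R5 ∞ :=
    { toPartialEquiv := E.toPartialEquiv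
      open_source := E.open_source
      open_target := E.open_target
      contMDiffOn_toFun := hEsm
      contMDiffOn_invFun := hEsym }
  have hφt : φ.target ⊆ goursatDomain := by
    intro y hy
    obtain ⟨h1, h2, -⟩ := hEt y hy
    have := (hG _ h2).1.2.1
    rwa [← he, e.right_inv h1] at this
  refine ⟨φ, ?_, hφt, isContactEquivalence_of_formPullback hε φ
    (fun i => (hσ.1 i).mono (subset_univ _)) (fun m _ => hs m (mem_univ m)) hφt ?_⟩
  · change m ∈ E.source
    have : c m ∈ e.source := hΨ0.mem_toOpenPartialHomeomorph_source hL (by simp)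
    simp [E, hm, this, hmG]
  · intro m' hm' i
    obtain ⟨h1, h2⟩ := hE m' hm'
    obtain ⟨⟨h3, -, h4⟩, -⟩ := hG _ h2
    have h5 : formPullback Ψ (goursatCoframe ε i) (c m') = inChart (σ i) m (c m') := by
      refine oneForm_congr_iff.2 fun v => ?_
      rw [formPullback_eq_euclPullback]
      exact h4 i v
    refine (formPullback_comp (goursatCoframe ε i) (mdifferentiableAt_chartAt h1)
      (h3.differentiableAt (by simp)).mdifferentiableAt).trans ?_
    refine Eq.trans ?_ (formPullback_chartAt_inChart (σ i) h1)
    unfold formPullback at h5 ⊢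
    rw [h5]

end ChartCoframe

theorem proposition4p8 (ε : ℝ) (hε : ε = 1 ∨ ε = -1) :
    (∀ (M : Type*) [TopologicalSpace M] [ChartedSpace R5 M] [IsManifold 𝓘(ℝ, R5) ∞ M]
      (σ : Fin 5 → Form M 1),
      IsCoframingOn σ Set.univ → StructureEquationsOn ε σ Set.univ →
      ∀ m : M, ∃ φ : PartialDiffeomorph 𝓘(ℝ, R5) 𝓘(ℝ, R5) M R5 ∞,
        m ∈ φ.source ∧ φ.target ⊆ goursatDomain ∧
        IsContactEquivalence φ (coframeGenerators σ) (pdeGenerators goursatRHS)) ∧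
    (∀ u ∈ goursatDomain, ∃ (V : Set R5) (τ : Fin 5 → Form R5 1),
      IsOpen V ∧ u ∈ V ∧ V ⊆ goursatDomain ∧
      IsCoframingOn τ V ∧ StructureEquationsOn ε τ V ∧
      ∀ (k : ℕ) (β : Form R5 k),
        AlgIdeal (coframeGenerators τ) V β ↔ AlgIdeal (pdeGenerators goursatRHS) V β) :=
  ⟨fun _ _ _ _ _ hσ hs m => exists_contactEquivalence_goursat hε hσ hs m, fun _ hu =>
    -- The coframing is defined globally, so the whole domain serves as the neighborhood of each
    -- point.
    ⟨goursatDomain, goursatCoframe ε, isOpen_goursatDomain, hu, subset_rfl,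
      goursatCoframe_realizes hε⟩⟩
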